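/- Let $G$ be a connected and simply connected Lie group whose $n$-dimensional Lie algebra $\mathfrak g$ is semisimple and unimodular, with Killing form $k$, and let $\pi : P \to M$ be a smooth principal $G$-bundle with right action $R_g$. For $\xi\in\mathfrak g$ let $\xi^P$ be its fundamental vector field on $P$. Notation. $\Gamma_G(TP)$ denotes the $C^\infty(M)$-module of $R_g$-invariant vector fields on $P$ (the Atiyah Lie algebroid) and $\Gamma_G(P,\mathfrak g)$ the module of smooth maps $v:P\to\mathfrak g$ with $v(p\cdot g)=\mathrm{Ad}_{g^{-1}}v(p)$, included in $\Gamma_G(TP)$ by $\iota(v)(p)=-v(p)^P_{|p}$. $\Omega^q_{\mathrm{Lie}}(P,\mathfrak g)$ (resp. $\Omega^q_{\mathrm{Lie}}(P)$) is the space of alternating $C^\infty(M)$-multilinear maps $\Gamma_G(TP)^q\to\Gamma_G(P,\mathfrak g)$ (resp. $\to C^\infty(M)$). For a manifold $N$, $\mathrm{TLA}(N,\mathfrak g)$ is the space of pairs $X\oplus\gamma$ of a vector field and a smooth map $N\to\mathfrak g$, with bracket $[X\oplus\gamma,Y\oplus\eta]=[X,Y]\oplus(X\cdot\eta-Y\cdot\gamma+[\gamma,\eta])$;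 $\Omega_{\mathrm{TLA}}(N,\mathfrak g)=\Omega(N)\otimes\bigwedge\mathfrak g^*\otimes\mathfrak g$ and $\Omega_{\mathrm{TLA}}(N)=\Omega(N)\otimes\bigwedge\mathfrak g^*$ are its spaces of forms. Put $\mathfrak g_{\mathrm{equ}}=\{\xi^P\oplus\xi : \xi\in\mathfrak g\}\subset \mathrm{TLA}(P,\mathfrak g)$; a form on $\mathrm{TLA}(P,\mathfrak g)$ is $\mathfrak g_{\mathrm{equ}}$-basic if its inner product with, and its Lie derivative along, every element of $\mathfrak g_{\mathrm{equ}}$ vanish. A basic form $\widehat\omega$ corresponds to a form $\omega$ on $\Gamma_G(TP)$ if $\omega(\mathsf X_1,\dots,\mathsf X_q)(p)=\widehat\omega(\widehat X_1,\dots,\widehat X_q)(p)$ for all $\mathsf X_k\in\Gamma_G(TP)$, all $p\in P$ and all $\widehat X_k=(\mathsf X_k+v_k^P)\oplus v_k$ with $v_k:P\to\mathfrak g$ smooth, where $v_k^P(p)=v_k(p)^P_{|p}$. Let $\varphi_i:P_{|U_i}\to U_i\times G$ be a local trivialization of $P$, with section $s_i(x)=\varphi_i^{-1}(x,e)$. For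 $p=s_i(x)\cdot g$ put $\nabla^{0,i}_{X|p}=TR_g\,Ts_i\,X_{|x}$, $\Psi_i(\gamma)(p)=\mathrm{Ad}_{g^{-1}}\gamma(x)$ and $S_i(X\oplus\gamma)=\nabla^{0,i}_X+\iota(\Psi_i(\gamma))$. The local trivialization of a $\Gamma_G(P,\mathfrak g)$-valued form $\omega$ is $\omega^i_{\mathrm{loc}}=\Psi_i^{-1}\circ\omega\circ S_i$ (with $\Psi_i^{-1}(v)=s_i^*v$), and similarly, evaluating on the section $s_i$, for $C^\infty(M)$-valued forms. (1) If $\widehat\omega$ is the $\mathfrak g_{\mathrm{equ}}$-basic form on $\mathrm{TLA}(P,\mathfrak g)$ with values in $\mathfrak g$ that corresponds to $\omega\in\Omega^q_{\mathrm{Lie}}(P,\mathfrak g)$, then $\omega^i_{\mathrm{loc}}=s_i^*\widehat\omega\in\Omega^q_{\mathrm{TLA}}(U_i,\mathfrak g)$, where $(s_i^*\widehat\omega)_x(X_k\oplus\gamma_k)=\widehat\omega_{s_i(x)}(T_xs_iX_k\oplus\gamma_k)$. The same holds for forms with complex coefficients, that is, with $\mathfrak g\otimes\mathbb C$ in place of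 $\mathfrak g$ as space of values. (2) Let $\nabla$ be a connection on $P$ with connection $1$-form $\omega_\nabla\in\Omega^1(P)\otimes\mathfrak g$, let $(E_a)$ be a basis of $\mathfrak g$ with dual basis $(\theta^a)$, write $\omega_\nabla=\omega_\nabla^a\otimes E_a$ and let $|k|=|\det (k(E_a,E_b))|$. Let $\omega^\nabla\in\Omega^1_{\mathrm{Lie}}(P,\mathfrak g)$, $\omega^\nabla(\mathsf X)=\omega_\nabla(\mathsf X)$, be the associated connection $1$-form on $\Gamma_G(TP)$. There is a unique form $\omega_{h,\omega}\in\Omega^n_{\mathrm{Lie}}(P)$, the volume form of the metric $h$ induced by $k$ and of $\nabla$, that is given in every local trivialization by $(-1)^n\sqrt{|k|}\,\omega_i^1\wedge\cdots\wedge\omega_i^n$, where $\omega^\nabla_{\mathrm{loc},i}=\omega_i^a E_a$. The unique $\mathfrak g_{\mathrm{equ}}$-basic form in $\Omega^n_{\mathrm{TLA}}(P)$ corresponding to $\omega_{h,\omega}$ is $$(-1)^n\sqrt{|k|}\,(\omega_\nabla^1-\theta^1)\wedge\cdots\wedge(\omega_\nabla^n-\theta^n).$$ This holds both for real-valued and for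 complex-valued forms. -/

import Mathlib

open scoped Manifold ContDiff Topology

noncomputable section

namespace Atiyah

/-! ### The Lie algebra of a smooth finite-dimensional Lie group -/

instance instCompleteSpaceOfFiniteDimensional (E : Type*) [NormedAddCommGroup E] [NormedSpace ℝ E]
    [FiniteDimensional ℝ E] : CompleteSpace E :=
  FiniteDimensional.complete ℝ E

instance instLieGroupMinSmoothness {E : Type*} [NormedAddCommGroup E] [NormedSpace ℝ E]
    {G : Type*} [TopologicalSpace G] [ChartedSpace E G] [Group G] [LieGroup 𝓘(ℝ, E) ∞ G] :
    LieGroup 𝓘(ℝ, E) (minSmoothness ℝ 3) G :=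
  LieGroup.of_le (n := ∞) (by
    rw [minSmoothness_of_isRCLikeNormedField]
    exact ENat.LEInfty.out)

/-- The Lie algebra `𝔤` of `G`: the tangent space at `1`, with the bracket of left-invariant
vector fields. As a vector space it is definitionally the model space `EG` of `G`. -/
abbrev LieAlg (EG : Type*) [NormedAddCommGroup EG] [NormedSpace ℝ EG]
    (G : Type*) [TopologicalSpace G] [ChartedSpace EG G] [Group G] : Type _ :=
  GroupLieAlgebra 𝓘(ℝ, EG) G

section Group

variable {EG : Type*} [NormedAddCommGroup EG] [NormedSpace ℝ EG]
  {G : Type*} [TopologicalSpace G] [ChartedSpace EG G] [Group G]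

/-- The adjoint action `Ad_g = T_1 (h ↦ g h g⁻¹)` of `G` on its Lie algebra. -/
def Ad (g : G) : LieAlg EG G →ₗ[ℝ] LieAlg EG G :=
  (show LieAlg EG G →L[ℝ] LieAlg EG G from
    mfderiv 𝓘(ℝ, EG) 𝓘(ℝ, EG) (fun h : G => g * h * g⁻¹) (1 : G)).toLinearMap

end Group

/-! ### Trivial Lie algebroids `TLA(N, 𝔤)` and their forms -/

section TLA

variable {E : Type*} [NormedAddCommGroup E] [NormedSpace ℝ E]
  {N : Type*} [TopologicalSpace N] [ChartedSpace E N] [IsManifold 𝓘(ℝ, E) ∞ N]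
  {EG : Type*} [NormedAddCommGroup EG] [NormedSpace ℝ EG]
  {G : Type*} [TopologicalSpace G] [ChartedSpace EG G] [Group G]
  {V : Type*} [NormedAddCommGroup V] [NormedSpace ℝ V]

/-- Smoothness of a vector field on a set. -/
def SmoothFieldOn (X : (x : N) → TangentSpace 𝓘(ℝ, E) x) (U : Set N) : Prop :=
  ContMDiffOn 𝓘(ℝ, E) (𝓘(ℝ, E).prod 𝓘(ℝ, E)) ∞
    (fun x => (⟨x, X x⟩ : TangentBundle 𝓘(ℝ, E) N)) U

variable (E EG G) in
/-- The fibre `T_x N ⊕ 𝔤` at `x` of the trivial Lie algebroid. -/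
abbrev TLAFiber (x : N) : Type _ := TangentSpace 𝓘(ℝ, E) x × LieAlg EG G

variable (E EG G) in
/-- Elements `X ⊕ γ` of `TLA(U, 𝔤)` for `U ⊆ N` open: a smooth vector field and a smooth
`𝔤`-valued function on `U` (the values outside `U` are irrelevant). -/
structure TLASection (U : Set N) where
  vec : (x : N) → TangentSpace 𝓘(ℝ, E) x
  alg : N → LieAlg EG G
  smooth_vec : SmoothFieldOn vec U
  smooth_alg : ContMDiffOn 𝓘(ℝ, E) 𝓘(ℝ, EG) ∞ (M' := EG) alg U

/-- The value of a section of `TLA(U, 𝔤)` at a point. -/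
def TLASection.val {U : Set N} (Y : TLASection E EG G U) (x : N) : TLAFiber E EG G x :=
  (Y.vec x, Y.alg x)

/-- The derivative `X · f` at a point, of a vector-valued function along a tangent vector. -/
def dirDeriv (f : N → V) (x : N) (v : TangentSpace 𝓘(ℝ, E) x) : V :=
  mfderiv 𝓘(ℝ, E) 𝓘(ℝ, V) f x v

/-- The bracket `[X ⊕ γ, Y ⊕ η] = [X, Y] ⊕ (X·η - Y·γ + [γ, η])` of the trivial Lie algebroid. -/
def tlaBracket (X Y : (x : N) → TangentSpace 𝓘(ℝ, E) x) (γ η : N → LieAlg EG G) (x : N) :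
    TLAFiber E EG G x :=
  (VectorField.mlieBracket 𝓘(ℝ, E) X Y x,
    (show LieAlg EG G from dirDeriv (V := EG) η x (X x))
      - (show LieAlg EG G from dirDeriv (V := EG) γ x (Y x)) + ⁅γ x, η x⁆)

variable (E N EG G V) in
/-- Fields of alternating `V`-valued `q`-linear maps on the fibres of the trivial Lie algebroid;
those that are smooth on `U` are the elements of total degree `q` of `Ω(U) ⊗ ⋀𝔤^* ⊗ V`. -/
abbrev TLAForm (q : ℕ) : Type _ := (x : N) → TLAFiber E EG G x [⋀^Fin q]→ₗ[ℝ] V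

/-- Smoothness on the open set `U`: smooth sections are mapped to smooth functions. -/
def TLAForm.SmoothOn {q : ℕ} (α : TLAForm E N EG G V q) (U : Set N) : Prop :=
  ∀ W : Set N, IsOpen W → W ⊆ U → ∀ Y : Fin q → TLASection E EG G W,
    ContMDiffOn 𝓘(ℝ, E) 𝓘(ℝ, V) ∞ (fun x => α x (fun k => (Y k).val x)) W

/-- A form in `Ω_TLA(U)`, as a multilinear map on sections with values in functions on `U`. -/
def TLAForm.onSections {q : ℕ} (α : TLAForm E N EG G V q) {U : Set N}
    (Y : Fin q → TLASection E EG G U) (x : U) : V :=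
  α x (fun k => (Y k).val x)

end TLA

/-! ### Principal bundles -/

section Bundle

variable (EM EP EG : Type*)
  [NormedAddCommGroup EM] [NormedSpace ℝ EM] [NormedAddCommGroup EP] [NormedSpace ℝ EP]
  [NormedAddCommGroup EG] [NormedSpace ℝ EG]
  {M P G : Type*} [TopologicalSpace M] [ChartedSpace EM M]
  [TopologicalSpace P] [ChartedSpace EP P]
  [TopologicalSpace G] [ChartedSpace EG G] [Group G]

/-- A smooth equivariant local trivialization `φ : P|_U ≃ U × G`. -/
structure LocalTriv (proj : P → M) (act : P → G → P) where
  baseSet : Set M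
  isOpen_baseSet : IsOpen baseSet
  toHomeo : OpenPartialHomeomorph P (M × G)
  source_eq : toHomeo.source = proj ⁻¹' baseSet
  target_eq : toHomeo.target = baseSet ×ˢ Set.univ
  smooth_toFun : ContMDiffOn 𝓘(ℝ, EP) (𝓘(ℝ, EM).prod 𝓘(ℝ, EG)) ∞ toHomeo toHomeo.source
  smooth_invFun : ContMDiffOn (𝓘(ℝ, EM).prod 𝓘(ℝ, EG)) 𝓘(ℝ, EP) ∞ toHomeo.symm toHomeo.target
  fst_eq : ∀ p ∈ toHomeo.source, (toHomeo p).1 = proj p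
  snd_act : ∀ p ∈ toHomeo.source, ∀ g : G, (toHomeo (act p g)).2 = (toHomeo p).2 * g

variable (M P G) in
/-- A smooth principal `G`-bundle `P → M` with right action `(p, g) ↦ p · g`. -/
structure PrincipalBundle where
  proj : P → M
  act : P → G → P
  smooth_proj : ContMDiff 𝓘(ℝ, EP) 𝓘(ℝ, EM) ∞ proj
  smooth_act : ContMDiff (𝓘(ℝ, EP).prod 𝓘(ℝ, EG)) 𝓘(ℝ, EP) ∞ (fun z : P × G => act z.1 z.2)
  act_one : ∀ p, act p 1 = p
  act_mul : ∀ p g h, act p (g * h) = act (act p g) h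
  proj_act : ∀ p g, proj (act p g) = proj p
  exists_localTriv : ∀ x : M, ∃ φ : LocalTriv EM EP EG proj act, x ∈ φ.baseSet

end Bundle

section Atiyah

variable {EM EP EG : Type*}
  [NormedAddCommGroup EM] [NormedSpace ℝ EM] [NormedAddCommGroup EP] [NormedSpace ℝ EP]
  [NormedAddCommGroup EG] [NormedSpace ℝ EG]
  {M P G : Type*} [TopologicalSpace M] [ChartedSpace EM M] [IsManifold 𝓘(ℝ, EM) ∞ M]
  [TopologicalSpace P] [ChartedSpace EP P] [IsManifold 𝓘(ℝ, EP) ∞ P]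
  [TopologicalSpace G] [ChartedSpace EG G] [Group G]
  {V : Type*} [NormedAddCommGroup V] [NormedSpace ℝ V]

/-- The local trivializations of a principal bundle. -/
abbrev PrincipalBundle.Triv (B : PrincipalBundle EM EP EG M P G) : Type _ :=
  LocalTriv EM EP EG B.proj B.act

variable (B : PrincipalBundle EM EP EG M P G)

/-- The fundamental vector field `ξ^P(p) = d/dt (p · exp (t ξ))|_{t = 0} = T_1 (g ↦ p · g) ξ`. -/
def fundamental (p : P) (ξ : LieAlg EG G) : TangentSpace 𝓘(ℝ, EP) p :=
  (mfderiv 𝓘(ℝ, EG) 𝓘(ℝ, EP) (fun g : G => B.act p g) 1 ξ : EP)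

/-- The derivative `T_p R_g : T_p P → T_{p · g} P` of the right translation by `g`. -/
def tangentAct (g : G) (p : P) : TangentSpace 𝓘(ℝ, EP) p →L[ℝ] TangentSpace 𝓘(ℝ, EP) (B.act p g) :=
  mfderiv 𝓘(ℝ, EP) 𝓘(ℝ, EP) (fun p : P => B.act p g) p

/-! ### The Atiyah Lie algebroid -/

/-- The ring `C^∞(M)`. -/
abbrev SmoothFun (EM M : Type*) [NormedAddCommGroup EM] [NormedSpace ℝ EM] [TopologicalSpace M]
    [ChartedSpace EM M] : Type _ :=
  C^∞⟮𝓘(ℝ, EM), M; 𝓘(ℝ, ℝ), ℝ⟯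

/-- Functions on `P` with values in `V`, as a module over `C^∞(M)` through `π^*`. -/
def FunOn (_B : PrincipalBundle EM EP EG M P G) (V : Type*) : Type _ := P → V

instance : AddCommGroup (FunOn B V) := inferInstanceAs (AddCommGroup (P → V))

instance : Module (SmoothFun EM M) (FunOn B V) where
  smul f v := fun p => f (B.proj p) • (v p : V)
  one_smul v := funext fun p => one_smul ℝ (v p : V)
  mul_smul f g v := funext fun p => mul_smul (f (B.proj p)) (g (B.proj p)) (v p : V)
  smul_zero f := funext fun p => smul_zero (A := V) (f (B.proj p))
  smul_add f v w := funext fun p => smul_add (f (B.proj p)) (v p : V) (w p : V)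
  add_smul f g v := funext fun p => add_smul (f (B.proj p)) (g (B.proj p)) (v p : V)
  zero_smul v := funext fun p => zero_smul ℝ (v p : V)

/-- Vector fields on `P`, as a module over `C^∞(M)` through `π^*`. -/
def FieldOn (_B : PrincipalBundle EM EP EG M P G) : Type _ := (p : P) → TangentSpace 𝓘(ℝ, EP) p

instance : AddCommGroup (FieldOn B) :=
  inferInstanceAs (AddCommGroup ((p : P) → TangentSpace 𝓘(ℝ, EP) p))

instance : Module (SmoothFun EM M) (FieldOn B) where
  smul f X := fun p => f (B.proj p) • (X p : TangentSpace 𝓘(ℝ, EP) p)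
  one_smul X := funext fun p => one_smul ℝ (X p : TangentSpace 𝓘(ℝ, EP) p)
  mul_smul f g X := funext fun p =>
    mul_smul (f (B.proj p)) (g (B.proj p)) (X p : TangentSpace 𝓘(ℝ, EP) p)
  smul_zero f := funext fun p => smul_zero (A := TangentSpace 𝓘(ℝ, EP) p) (f (B.proj p))
  smul_add f X Y := funext fun p =>
    smul_add (f (B.proj p)) (X p : TangentSpace 𝓘(ℝ, EP) p) (Y p : TangentSpace 𝓘(ℝ, EP) p)
  add_smul f g X := funext fun p =>
    add_smul (f (B.proj p)) (g (B.proj p)) (X p : TangentSpace 𝓘(ℝ, EP) p)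
  zero_smul X := funext fun p => zero_smul ℝ (X p : TangentSpace 𝓘(ℝ, EP) p)

/-- `Γ_G(TP)`: the smooth vector fields `X` on `P` with `R_{g *} X = X` for all `g`, a
`C^∞(M)`-module. -/
def InvariantField : Submodule (SmoothFun EM M) (FieldOn B) where
  carrier := {X | SmoothFieldOn (E := EP) (N := P) X Set.univ ∧
    ∀ (g : G) (p : P), tangentAct B g p (X p) = X (B.act p g)}
  add_mem' {X Y} hX hY := by
    refine ⟨ContMDiffOn.add_section (s := X) (t := Y) hX.1 hY.1, fun g p => ?_⟩
    have h := (tangentAct B g p).map_add (X p) (Y p)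
    rw [hX.2, hY.2] at h
    exact h
  zero_mem' := ⟨(Bundle.contMDiff_zeroSection ℝ
    (TangentSpace 𝓘(ℝ, EP) : P → Type _)).contMDiffOn, fun g p => (tangentAct B g p).map_zero⟩
  smul_mem' f X hX := by
    refine ⟨ContMDiffOn.smul_section (s := X) ((f.contMDiff.comp B.smooth_proj).contMDiffOn) hX.1,
      fun g p => ?_⟩
    have h := (tangentAct B g p).map_smul (f (B.proj p)) (X p)
    have e : f (B.proj (B.act p g)) = f (B.proj p) := by rw [B.proj_act]
    rw [hX.2] at h
    exact h.trans (congrArg (fun c : ℝ => c • X (B.act p g)) e.symm)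

/-- Coefficients for forms: a space `V` with the operators of `G` and of `𝔤` on it. Only the
instances `adjoint`, `adjointC` and `scalar` below are used. -/
structure Coeff (EG G V : Type*) [NormedAddCommGroup EG] [NormedSpace ℝ EG] [TopologicalSpace G]
    [ChartedSpace EG G] [Group G] [NormedAddCommGroup V] [NormedSpace ℝ V] where
  act : G → V →ₗ[ℝ] V
  infAct : LieAlg EG G → V →ₗ[ℝ] V

/-- The `C^∞(M)`-module of smooth maps `v : P → V` with `v (p · g) = g⁻¹ · v p`. For the adjoint
coefficients it is the kernel `Γ_G(P, 𝔤)` of the Atiyah Lie algebroid; for trivial scalar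
coefficients it consists of the invariant functions, that is of `π^* C^∞(M)`. -/
def EquivariantMap (C : Coeff EG G V) : Submodule (SmoothFun EM M) (FunOn B V) where
  carrier := {v | ContMDiff 𝓘(ℝ, EP) 𝓘(ℝ, V) ∞ (v : P → V) ∧
    ∀ (p : P) (g : G), v (B.act p g) = C.act g⁻¹ (v p)}
  add_mem' {v w} hv hw := by
    refine ⟨ContMDiff.add (G := V) hv.1 hw.1, fun p g => ?_⟩
    have h := (C.act g⁻¹).map_add (v p) (w p)
    rw [← hv.2, ← hw.2] at h
    exact h.symm
  zero_mem' := ⟨contMDiff_const, fun p g => ((C.act g⁻¹).map_zero).symm⟩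
  smul_mem' f v hv := by
    refine ⟨ContMDiff.smul (f.contMDiff.comp B.smooth_proj) hv.1, fun p g => ?_⟩
    have h := (C.act g⁻¹).map_smul (f (B.proj p)) (v p)
    have e : f (B.proj (B.act p g)) = f (B.proj p) := by rw [B.proj_act]
    rw [← hv.2] at h
    exact (congrArg (fun c : ℝ => c • (v (B.act p g) : V)) e).trans h.symm

/-- Forms of degree `q` on the Atiyah Lie algebroid `Γ_G(TP)`: the alternating
`C^∞(M)`-multilinear maps to the module of equivariant maps. This is `Ω_lie^q(P, 𝔤)` for adjoint
coefficients and `Ω_lie^q(P)` for scalar ones. -/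
abbrev AtiyahForm (C : Coeff EG G V) (q : ℕ) : Type _ :=
  InvariantField B [⋀^Fin q]→ₗ[SmoothFun EM M] EquivariantMap B C

variable {B}

/-- The value at `p` of an invariant vector field. -/
def InvariantField.val (X : InvariantField B) (p : P) : TangentSpace 𝓘(ℝ, EP) p := X.1 p

/-- The value at `p` of `ω(X_1, …, X_q)`. -/
def AtiyahForm.val {C : Coeff EG G V} {q : ℕ} (α : AtiyahForm B C q)
    (X : Fin q → InvariantField B) (p : P) : V := (α X).1 p

/-! ### Local trivializations -/

/-- The local section `s(x) = φ⁻¹(x, e)`. -/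
def LocalTriv.sec (φ : B.Triv) (x : M) : P := φ.toHomeo.symm (x, 1)

/-- The isomorphism `Ψ`: `Ψ(γ)(p) = Ad_{g⁻¹} γ(x)` for `p = s(x) · g`. -/
def LocalTriv.Psi (φ : B.Triv) (γ : M → LieAlg EG G) (p : P) : LieAlg EG G :=
  Ad (φ.toHomeo p).2⁻¹ (γ (B.proj p))

/-- The inverse of `Ψ`: `Ψ⁻¹(v) = s^* v`. -/
def LocalTriv.PsiInv (φ : B.Triv) (v : P → V) (x : M) : V := v (φ.sec x)

/-- The flat connection `∇⁰`: `∇⁰_X(p) = T R_g (T_x s (X(x)))` for `p = s(x) · g`. -/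
def LocalTriv.nablaZero (φ : B.Triv) (X : (x : M) → TangentSpace 𝓘(ℝ, EM) x) (p : P) :
    TangentSpace 𝓘(ℝ, EP) p :=
  (tangentAct B (φ.toHomeo p).2 (φ.sec (B.proj p))
    (mfderiv 𝓘(ℝ, EM) 𝓘(ℝ, EP) φ.sec (B.proj p) (X (B.proj p))) : EP)

variable (B) in
/-- The inclusion `ι(v)(p) = - v(p)^P(p)` of the kernel. -/
def iota (v : P → LieAlg EG G) (p : P) : TangentSpace 𝓘(ℝ, EP) p := - fundamental B p (v p)

/-- `S(X ⊕ γ) = ∇⁰_X + ι(Ψ(γ))`, an invariant vector field on `P|_U`. -/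
def LocalTriv.S (φ : B.Triv) (Y : TLASection EM EG G φ.baseSet) (p : P) :
    TangentSpace 𝓘(ℝ, EP) p :=
  φ.nablaZero Y.vec p + iota B (φ.Psi Y.alg) p

open Classical in
/-- The restriction of a form to the invariant vector fields `Z_k` on some `P|_U`: its value at `p`
is that of `ω(X_1, …, X_q)`, where the `X_k` are global invariant vector fields which coincide
with the `Z_k` over a neighbourhood of `π(p)`. -/
def AtiyahForm.restrict {C : Coeff EG G V} {q : ℕ} (α : AtiyahForm B C q)
    (Z : Fin q → (p : P) → TangentSpace 𝓘(ℝ, EP) p) (p : P) : V :=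
  if h : ∃ X : Fin q → InvariantField B, ∃ W ∈ 𝓝 (B.proj p), ∀ k, ∀ p' : P, B.proj p' ∈ W →
      (X k).val p' = Z k p'
  then α.val h.choose p else 0

/-- The local trivialization `ω_loc = Ψ⁻¹ ∘ ω ∘ S` of a form, as a map on sections of
`TLA(U, 𝔤)`. -/
def AtiyahForm.loc {C : Coeff EG G V} {q : ℕ} (α : AtiyahForm B C q) (φ : B.Triv)
    (Y : Fin q → TLASection EM EG G φ.baseSet) (x : φ.baseSet) : V :=
  φ.PsiInv (α.restrict (fun k => φ.S (Y k))) x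

/-- The pull-back `s^* : Ω_TLA(P) → Ω_TLA(U)`, which is the identity on `𝔤`:
`(s^* ω)_x (X_k ⊕ γ_k) = ω_{s(x)} (T_x s X_k ⊕ γ_k)`. -/
def TLAForm.pullback {q : ℕ} (α : TLAForm EP P EG G V q) (φ : B.Triv) :
    TLAForm EM M EG G V q :=
  fun x => (α (φ.sec x)).compLinearMap
    (LinearMap.prodMap (mfderiv 𝓘(ℝ, EM) 𝓘(ℝ, EP) φ.sec x).toLinearMap LinearMap.id)

/-! ### Basic forms for `𝔤_equ = {ξ^P ⊕ ξ}` -/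

variable (B) in
/-- Horizontality: `i_{ξ^P ⊕ ξ} ω = 0` for all `ξ`. -/
def IsHorizontal {q : ℕ} (α : TLAForm EP P EG G V q) : Prop :=
  ∀ (ξ : LieAlg EG G) (p : P) (k : Fin q) (Y : Fin q → TLAFiber EP EG G p),
    Y k = (fundamental B p ξ, ξ) → α p Y = 0

variable (B) in
/-- The Lie derivative along `ξ^P ⊕ ξ` of a form on `TLA(P, 𝔤)`, evaluated on sections:
`(ξ^P ⊕ ξ) · ω(Y_1, …, Y_q) - ∑ ω(Y_1, …, [ξ^P ⊕ ξ, Y_k], …, Y_q)`, where `X ⊕ γ` operates on a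
`V`-valued function `f` by `X · f + γ · f`. -/
def lieDeriv (C : Coeff EG G V) {q : ℕ} (ξ : LieAlg EG G) (α : TLAForm EP P EG G V q)
    (Y : Fin q → TLASection EP EG G (Set.univ : Set P)) (p : P) : V :=
  dirDeriv (fun p' => α p' (fun k => (Y k).val p')) p (fundamental B p ξ)
    + C.infAct ξ (α p (fun k => (Y k).val p))
    - ∑ k, α p (Function.update (fun j => (Y j).val p) k
        (tlaBracket (fun p' => fundamental B p' ξ) (Y k).vec (fun _ => ξ) (Y k).alg p))

variable (B) in
/-- The `𝔤_equ`-basic forms on `TLA(P, 𝔤)`: smooth, horizontal and invariant. -/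
def IsBasic (C : Coeff EG G V) {q : ℕ} (α : TLAForm EP P EG G V q) : Prop :=
  α.SmoothOn Set.univ ∧ IsHorizontal B α ∧
    ∀ (ξ : LieAlg EG G) (Y : Fin q → TLASection EP EG G (Set.univ : Set P)) (p : P),
      lieDeriv B C ξ α Y p = 0

/-- `λ(ω') = ω`, the relation between basic forms `ω'` on `TLA(P, 𝔤)` and forms `ω` on the Atiyah
Lie algebroid: `ω(X_1, …, X_q)(p) = ω'(X'_1, …, X'_q)(p)` for all families
`X'_k = X_k ⊕ 0 + (v_k^P ⊕ v_k)` in `Γ_G(TP) ⊕ Z` over `X_1, …, X_q`. Here `Z` is the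
`C^∞(P)`-module generated by `𝔤_equ`; its elements are the `v^P ⊕ v` with `v : P → 𝔤` smooth. -/
def Corresponds {C : Coeff EG G V} {q : ℕ} (β : TLAForm EP P EG G V q) (α : AtiyahForm B C q) :
    Prop :=
  ∀ (X : Fin q → InvariantField B) (v : Fin q → P → LieAlg EG G),
    (∀ k, ContMDiff 𝓘(ℝ, EP) 𝓘(ℝ, EG) ∞ (M' := EG) (v k)) →
    ∀ p : P, α.val X p = β p (fun k => ((X k).val p + fundamental B p (v k p), v k p))

/-! ### The coefficients -/

section Coefficients

variable (EG G) [FiniteDimensional ℝ EG] [LieGroup 𝓘(ℝ, EG) ∞ G]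

/-- Kernel-valued forms: `𝔤` with `Ad` and `ad`. -/
def adjoint : Coeff EG G EG where
  act g := (Ad g : LieAlg EG G →ₗ[ℝ] LieAlg EG G)
  infAct ξ := (LieAlgebra.ad ℝ (LieAlg EG G) ξ : LieAlg EG G →ₗ[ℝ] LieAlg EG G)

/-- Kernel-valued forms with complex coefficients: `𝔤 ⊗ ℂ = 𝔤 ⊕ i 𝔤`, a pair being the real and
the imaginary part. -/
def adjointC : Coeff EG G (EG × EG) where
  act g := ((adjoint EG G).act g).prodMap ((adjoint EG G).act g)
  infAct ξ := ((adjoint EG G).infAct ξ).prodMap ((adjoint EG G).infAct ξ)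

/-- Function-valued forms: real or complex scalars with trivial operators. -/
def scalar (𝕜 : Type*) [RCLike 𝕜] : Coeff EG G 𝕜 where
  act _ := LinearMap.id
  infAct _ := 0

end Coefficients

/-! ### Connections and the volume form -/

section Connection

variable [FiniteDimensional ℝ EG] [LieGroup 𝓘(ℝ, EG) ∞ G]

variable (B) in
/-- A connection on the principal bundle, given by its connection `1`-form `ω_∇`. -/
structure Connection where
  form : (p : P) → TangentSpace 𝓘(ℝ, EP) p →ₗ[ℝ] LieAlg EG G
  smooth_form : ∀ (W : Set P), IsOpen W → ∀ X : (p : P) → TangentSpace 𝓘(ℝ, EP) p,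
    SmoothFieldOn X W → ContMDiffOn 𝓘(ℝ, EP) 𝓘(ℝ, EG) ∞ (M' := EG) (fun p => form p (X p)) W
  form_fundamental : ∀ (p : P) (ξ : LieAlg EG G), form p (fundamental B p ξ) = ξ
  form_act : ∀ (g : G) (p : P) (w : TangentSpace 𝓘(ℝ, EP) p),
    form (B.act p g) (tangentAct B g p w) = Ad g⁻¹ (form p w)

/-- The connection `1`-form `ω^∇ ∈ Ω_lie^1(P, 𝔤)` of the algebroid connection `∇` (the horizontal
lift), characterized by `X = ∇_{π_* X} - ι(ω^∇(X))`: the restriction of `ω_∇` to `Γ_G(TP)`. -/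
def Connection.lieForm (A : Connection B) : AtiyahForm B (adjoint EG G) 1 where
  toFun X := ⟨fun p => (A.form p ((X 0).val p) : EG),
    contMDiffOn_univ.1 (A.smooth_form Set.univ isOpen_univ _ (X 0).2.1), fun p g => by
      have h := A.form_act g p ((X 0).val p)
      rw [show tangentAct B g p ((X 0).val p) = (X 0).val (B.act p g) from (X 0).2.2 g p] at h
      exact h⟩
  map_update_add' X i Y Z := by
    obtain rfl : i = 0 := Subsingleton.elim _ _
    refine Subtype.ext (funext fun p => ?_)
    simp only [Function.update_self]
    exact (A.form p).map_add (Y.val p) (Z.val p)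
  map_update_smul' X i f Y := by
    obtain rfl : i = 0 := Subsingleton.elim _ _
    refine Subtype.ext (funext fun p => ?_)
    simp only [Function.update_self]
    exact (A.form p).map_smul (f (B.proj p)) (Y.val p)
  map_eq_zero_of_eq' X i j _ hij := (hij (Subsingleton.elim _ _)).elim

/-- `√|k|`, with `|k|` the absolute value of the determinant of the matrix `k(E_a, E_b)` of the
Killing form. In each local trivialization it is also `√|h_loc|`, as `h_loc = k`. -/
def sqrtKilling {n : ℕ} (b : Module.Basis (Fin n) ℝ (LieAlg EG G)) : ℝ :=
  Real.sqrt |(Matrix.of fun i j => killingForm ℝ (LieAlg EG G) (b i) (b j)).det|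

/-- The wedge product `α^1 ∧ … ∧ α^n` of linear forms, with value `det (α^i(Y_j))`. -/
def wedge {W : Type*} [AddCommGroup W] [Module ℝ W] {n : ℕ} (α : Fin n → W →ₗ[ℝ] ℝ) :
    W [⋀^Fin n]→ₗ[ℝ] ℝ :=
  Matrix.detRowAlternating.compLinearMap (LinearMap.pi α)

/-- `ω` is the volume form `ω_{h, ω}` of the metric given by the Killing form and of the connection:
in every local trivialization, `ω_loc = (-1)^n √|h_loc| ω^1 ∧ … ∧ ω^n`, where the `1`-forms `ω^a`
(the mixed basis) are the components of the local trivialization of the connection `1`-form. -/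
def IsVolumeForm {𝕜 : Type*} [RCLike 𝕜] {n : ℕ} (b : Module.Basis (Fin n) ℝ (LieAlg EG G))
    (A : Connection B) (α : AtiyahForm B (scalar EG G 𝕜) n) : Prop :=
  ∀ (φ : B.Triv) (Y : Fin n → TLASection EM EG G φ.baseSet) (x : φ.baseSet),
    α.loc φ Y x = (((-1) ^ n * sqrtKilling b *
      (Matrix.of fun i j => b.coord i (A.lieForm.loc φ (fun _ => Y j) x)).det : ℝ) : 𝕜)

/-- The form `(-1)^n √|k| (ω_∇^1 - θ^1) ∧ … ∧ (ω_∇^n - θ^n)` on `TLA(P, 𝔤)`, where `ω_∇^a` are the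
components of the connection form in the basis `b` and `θ^a` is the dual basis. -/
def volumeTLAForm (𝕜 : Type*) [RCLike 𝕜] {n : ℕ} (b : Module.Basis (Fin n) ℝ (LieAlg EG G))
    (A : Connection B) : TLAForm EP P EG G 𝕜 n :=
  fun p => (RCLike.ofRealCLM (K := 𝕜)).toLinearMap.compAlternatingMap
    (((-1 : ℝ) ^ n * sqrtKilling b) • wedge fun i =>
      (b.coord i ∘ₗ A.form p) ∘ₗ LinearMap.fst ℝ (TangentSpace 𝓘(ℝ, EP) p) (LieAlg EG G)
        - b.coord i ∘ₗ LinearMap.snd ℝ (TangentSpace 𝓘(ℝ, EP) p) (LieAlg EG G))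

end Connection

end Atiyah

end Atiyah

end

/-! Kernel-valued forms. A form on the Atiyah Lie algebroid is `C^∞(M)`-multilinear, so bump
functions on `M` show that its value at `p` depends only on its arguments over a neighbourhood of
`π(p)` (`AtiyahForm.val_congr`). Hence `ω_loc` at `x` can be computed at `s(x)` with any global
invariant extensions of the fields `S(X_k ⊕ γ_k)`. On the section, `S(X ⊕ γ)` equals `Ts X - γ^P`.
In the correspondence one is free to add `v_k^P ⊕ v_k`; with the constant `v_k = γ_k(x)` the
vertical part cancels and `Ts X_k ⊕ γ_k` remains, which is the argument of `s^* ω̂`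
(`loc_eq_pullback`). The argument is the same for every space of values.

Volume form. Everything is reduced to the `𝔤`-valued one-form `τ = ω_∇ - θ` on `TLA(P, 𝔤)`: the
proposed form is a fixed determinant on `𝔤` evaluated on `τ(Y_1), …, τ(Y_n)`. Since `ω_∇(ξ^P) = ξ`,
the form `τ` kills `ξ^P ⊕ ξ`. Its Lie derivative, including the `ad ξ` term on values, vanishes
(`Connection.lieDeriv_tlaForm`). The Leibniz rule therefore leaves only the derivation of the
determinant by `ad ξ`, a multiple of `tr (ad ξ) = 0` (`sum_basisVolume_update`).

For the restriction to invariant fields to be a function on `M`, invariance under all of `G` is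
needed. It follows from the infinitesimal one because `G` is connected (`basisVolume_Ad`).

The analytic input is one formula: the derivative in `g` of the pull-back of a one-form by `R_g` is
its Lie derivative along the fundamental field (`mfderiv_pullback_act`). Applied to `G` operating on
itself it gives the derivative of `Ad`, and applied to `P` the Lie derivative of `ω_∇`.

Both uniqueness claims are surjectivity statements. Each invariant field is locally some `S(Y)`
(`LocalTriv.S_toTLASection`), so local trivializations determine a form on the algebroid. Each
tangent vector of `P` is the value of an invariant field (`exists_invariantField_val_eq`), so the
correspondence determines the form on `TLA(P, 𝔤)`. -/

noncomputable section

namespace Atiyah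

/-! ### Calculus in normed spaces -/

section Calculus

variable {E Z F : Type*} [NormedAddCommGroup E] [NormedSpace ℝ E]
  [NormedAddCommGroup Z] [NormedSpace ℝ Z] [NormedAddCommGroup F] [NormedSpace ℝ F]

/-- A one-form `θ` is pulled back along a family `Φ(·, z)` of maps with `Φ(x, z₀) = x`. The
derivative in `z` of the pull-back is the Lie derivative of `θ` along `V = ∂_ξ Φ(·, z₀)`. -/
lemma hasFDerivAt_pullback_family {Φ : E × Z → E} {x₀ : E} {z₀ : Z}
    (hΦ : ContDiffAt ℝ 2 Φ (x₀, z₀)) (hid : ∀ᶠ x in 𝓝 x₀, Φ (x, z₀) = x)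
    {θ : E → E →L[ℝ] F} (hθ : DifferentiableAt ℝ θ x₀) {y : E → E} (hy : DifferentiableAt ℝ y x₀)
    {ξ : Z} {V : E → E} (hV : ∀ᶠ x in 𝓝 x₀, V x = fderiv ℝ (fun z => Φ (x, z)) z₀ ξ) :
    DifferentiableAt ℝ (fun z => θ (Φ (x₀, z)) (fderiv ℝ (fun x => Φ (x, z)) x₀ (y x₀))) z₀ ∧
    fderiv ℝ (fun z => θ (Φ (x₀, z)) (fderiv ℝ (fun x => Φ (x, z)) x₀ (y x₀))) z₀ ξ =
      fderiv ℝ (fun x => θ x (y x)) x₀ (V x₀) - θ x₀ (VectorField.lieBracket ℝ V y x₀) := by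
  have hev : ∀ᶠ q in 𝓝 (x₀, z₀), DifferentiableAt ℝ Φ q := by
    filter_upwards [hΦ.eventually (by simp)] with q hq using hq.differentiableAt (by simp)
  have hD : DifferentiableAt ℝ (fderiv ℝ Φ) (x₀, z₀) :=
    (hΦ.fderiv_right (m := 1) (by norm_num)).differentiableAt (by simp)
  have hsymm : IsSymmSndFDerivAt ℝ Φ (x₀, z₀) := hΦ.isSymmSndFDerivAt (by simp)
  have part1 : ∀ {x z}, DifferentiableAt ℝ Φ (x, z) →
      HasFDerivAt (fun x => Φ (x, z)) ((fderiv ℝ Φ (x, z)).comp (.inl ℝ E Z)) x := by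
    intro x z h
    exact h.hasFDerivAt.comp x (hasFDerivAt_prodMk_left x z)
  have part2 : ∀ {x z}, DifferentiableAt ℝ Φ (x, z) →
      HasFDerivAt (fun z => Φ (x, z)) ((fderiv ℝ Φ (x, z)).comp (.inr ℝ E Z)) z := by
    intro x z h
    exact h.hasFDerivAt.comp z (hasFDerivAt_prodMk_right x z)
  have hx : ∀ᶠ x in 𝓝 x₀, DifferentiableAt ℝ Φ (x, z₀) :=
    (Continuous.prodMk_left z₀).continuousAt.eventually hev
  have hz : ∀ᶠ z in 𝓝 z₀, DifferentiableAt ℝ Φ (x₀, z) :=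
    (Continuous.prodMk_right x₀).continuousAt.eventually hev
  have hV' : V =ᶠ[𝓝 x₀] fun x => fderiv ℝ Φ (x, z₀) (0, ξ) := by
    filter_upwards [hV, hx] with x h1 h2
    rw [h1, (part2 h2).fderiv]; simp
  -- The derivative of `V` is the mixed second derivative of `Φ`, first in `z` along `ξ` and then in
  -- `x`.
  have hVd : HasFDerivAt V (((fderiv ℝ (fderiv ℝ Φ) (x₀, z₀)).comp (.inl ℝ E Z)).flip (0, ξ)) x₀ := by
    refine HasFDerivAt.congr_of_eventuallyEq ?_ hV'
    have h := HasFDerivAt.comp (f := fun x => (x, z₀)) x₀ hD.hasFDerivAt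
      (hasFDerivAt_prodMk_left x₀ z₀)
    simpa using h.clm_apply (hasFDerivAt_const ((0, ξ) : E × Z) x₀)
  have hfst : (fderiv ℝ Φ (x₀, z₀)).comp (.inl ℝ E Z) = ContinuousLinearMap.id ℝ E := by
    have h1 := part1 hx.self_of_nhds
    have h2 : HasFDerivAt (fun x => Φ (x, z₀)) (ContinuousLinearMap.id ℝ E) x₀ :=
      (hasFDerivAt_id x₀).congr_of_eventuallyEq hid
    exact h1.unique h2
  have hW := hD.hasFDerivAt.comp z₀ (hasFDerivAt_prodMk_right x₀ z₀)
  have hΦz := part2 hz.self_of_nhds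
  have hΦ0 : Φ (x₀, z₀) = x₀ := hid.self_of_nhds
  have hθz : HasFDerivAt (fun z => θ (Φ (x₀, z)))
      ((fderiv ℝ θ x₀).comp ((fderiv ℝ Φ (x₀, z₀)).comp (.inr ℝ E Z))) z₀ := by
    refine HasFDerivAt.comp z₀ ?_ hΦz
    rw [hΦ0]; exact hθ.hasFDerivAt
  have hh := hθz.clm_apply (hW.clm_apply (hasFDerivAt_const ((y x₀, 0) : E × Z) z₀))
  -- Partial derivatives are replaced by the full derivative of `Φ`, which is legitimate only for
  -- `z` near `z₀`.
  have heq : (fun z => θ (Φ (x₀, z)) (fderiv ℝ (fun x => Φ (x, z)) x₀ (y x₀))) =ᶠ[𝓝 z₀]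
      fun z => θ (Φ (x₀, z)) ((fderiv ℝ Φ ∘ fun z => (x₀, z)) z (y x₀, 0)) := by
    filter_upwards [hz] with z hz
    rw [(part1 hz).fderiv]; simp
  have hh' := hh.congr_of_eventuallyEq heq
  refine ⟨hh'.differentiableAt, ?_⟩
  have hfst' : fderiv ℝ Φ (x₀, z₀) (y x₀, 0) = y x₀ := by
    simpa using congrArg (fun L => L (y x₀)) hfst
  rw [hh'.fderiv, VectorField.lieBracket, hVd.fderiv,
    (hθ.hasFDerivAt.clm_apply hy.hasFDerivAt).fderiv]
  -- After the terms in the derivative of `y` cancel, the two sides differ only in the order of the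
  -- mixed second derivative.
  have h3 := hsymm (y x₀, 0) (0, ξ)
  simp [hfst', hΦ0, hV'.self_of_nhds, h3, add_comm]

end Calculus

/-! ### Determinants and traces -/

open Matrix in
/-- The derivation of `det` induced by `B` is multiplication with the trace of `B`. -/
lemma sum_det_updateRow_mul {n R : Type*} [Fintype n] [DecidableEq n] [CommRing R]
    (A B : Matrix n n R) : ∑ k, (A.updateRow k ((A * B) k)).det = B.trace * A.det := by
  -- Cramer's rule turns each determinant into a diagonal entry of `A * B * adj A`; cyclicity of the
  -- trace and `adj A * A = det A` finish, without inverting `A`.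
  have h : ∀ k, (A.updateRow k ((A * B) k)).det = (A * B * A.adjugate) k k := by
    intro k
    rw [← cramer_transpose_apply, cramer_eq_adjugate_mulVec, ← adjugate_transpose, mulVec_transpose]
    rfl
  simp_rw [h]
  change (A * B * A.adjugate).trace = _
  rw [Matrix.mul_assoc, trace_mul_comm, Matrix.mul_assoc, adjugate_mul]
  simp [mul_comm]

/-- For the determinant in a basis `b`, the derivation induced by an endomorphism `f` is
multiplication with the trace of `f`. -/
lemma sum_det_update_map {W : Type*} [AddCommGroup W] [Module ℝ W] {n : ℕ}
    (b : Module.Basis (Fin n) ℝ W) (f : W →ₗ[ℝ] W) (v : Fin n → W) :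
    ∑ k, wedge b.coord (Function.update v k (f (v k)))
      = LinearMap.trace ℝ W f * wedge b.coord v := by
  have hw : ∀ u : Fin n → W, wedge b.coord u = (Matrix.of fun i j => b.repr (u i) j).det := by
    intro u; rfl
  simp_rw [hw]
  -- The coordinates of the vectors are rows here, so `f` acts by right multiplication with the
  -- transpose of its matrix.
  rw [LinearMap.trace_eq_matrix_trace ℝ b, ← Matrix.trace_transpose, ← sum_det_updateRow_mul]
  refine Finset.sum_congr rfl fun k _ => congrArg Matrix.det ?_
  ext i j
  by_cases h : i = k
  · subst h
    simp only [Function.update_self, Matrix.of_apply, Matrix.updateRow_self, Matrix.mul_apply,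
      Matrix.transpose_apply]
    conv_lhs => rw [← LinearMap.toMatrix_mulVec_repr b b f (v i)]
    simp [Matrix.mulVec, dotProduct, mul_comm]
  · simp [h, Matrix.updateRow_apply]

/-! ### Vector fields and one-forms in a chart -/

section Chart

variable {E : Type*} [NormedAddCommGroup E] [NormedSpace ℝ E]
  {N : Type*} [TopologicalSpace N] [ChartedSpace E N]
  {F : Type*} [NormedAddCommGroup F] [NormedSpace ℝ F]

/-- The derivative of a map of manifolds, as a linear map of the model spaces. -/
def modelDeriv {E E' N N' : Type*} [NormedAddCommGroup E] [NormedSpace ℝ E]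
    [NormedAddCommGroup E'] [NormedSpace ℝ E'] [TopologicalSpace N] [ChartedSpace E N]
    [TopologicalSpace N'] [ChartedSpace E' N'] (f : N → N') (p : N) : E →L[ℝ] E' :=
  mfderiv 𝓘(ℝ, E) 𝓘(ℝ, E') f p

/-- The derivative of the inverse of the chart at `p`, as an endomorphism of the model space. -/
def chartSymmDeriv (p : N) (x : E) : E →L[ℝ] E :=
  mfderivWithin 𝓘(ℝ, E) 𝓘(ℝ, E) (extChartAt 𝓘(ℝ, E) p).symm (Set.range 𝓘(ℝ, E)) x

/-- The derivative of the chart at `p`, as an endomorphism of the model space. -/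
def chartDeriv (p q : N) : E →L[ℝ] E :=
  mfderiv 𝓘(ℝ, E) 𝓘(ℝ, E) (extChartAt 𝓘(ℝ, E) p) q

/-- A one-form, read in the chart at `p`. -/
def chartForm [FiniteDimensional ℝ E] (θ : (p : N) → TangentSpace 𝓘(ℝ, E) p →ₗ[ℝ] F) (p : N)
    (x : E) : E →L[ℝ] F :=
  LinearMap.toContinuousLinearMap (𝕜 := ℝ) (E := E)
    ((show E →ₗ[ℝ] F from θ ((extChartAt 𝓘(ℝ, E) p).symm x)) ∘ₗ (chartSymmDeriv p x).toLinearMap)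

/-- A vector field, read in the chart at `p`. -/
def chartField (X : (p : N) → TangentSpace 𝓘(ℝ, E) p) (p : N) (x : E) : E :=
  chartDeriv p ((extChartAt 𝓘(ℝ, E) p).symm x)
    (X ((extChartAt 𝓘(ℝ, E) p).symm x) : E)

lemma extChartAt_target_mem_nhds_self (p : N) :
    (extChartAt 𝓘(ℝ, E) p).target ∈ 𝓝 (extChartAt 𝓘(ℝ, E) p p) :=
  extChartAt_target_mem_nhds (I := 𝓘(ℝ, E)) p

lemma chartField_apply (X : (p : N) → TangentSpace 𝓘(ℝ, E) p)
    {p q : N} (hq : q ∈ (extChartAt 𝓘(ℝ, E) p).source) :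
    chartField X p (extChartAt 𝓘(ℝ, E) p q) = chartDeriv (E := E) p q (X q) := by
  rw [chartField, (extChartAt 𝓘(ℝ, E) p).left_inv hq]

variable [IsManifold 𝓘(ℝ, E) ∞ N]

instance instIsManifoldOne : IsManifold 𝓘(ℝ, E) 1 N := IsManifold.of_le (n := ∞) (by simp)
instance instIsManifoldTwo : IsManifold 𝓘(ℝ, E) 2 N :=
  IsManifold.of_le (n := ∞) ENat.LEInfty.out

lemma chartSymmDeriv_chartDeriv {p : N} {x : E} (hx : x ∈ (extChartAt 𝓘(ℝ, E) p).target) (w : E) :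
    chartSymmDeriv p x (chartDeriv p ((extChartAt 𝓘(ℝ, E) p).symm x) w) = w :=
  congrArg (fun L : E →L[ℝ] E => L w)
    (mfderivWithin_extChartAt_symm_comp_mfderiv_extChartAt (I := 𝓘(ℝ, E)) hx)

lemma chartDeriv_self (p : N) : chartDeriv p p = ContinuousLinearMap.id ℝ E :=
  mfderiv_extChartAt_self (I := 𝓘(ℝ, E)) (x := p)

lemma chartSymmDeriv_self (p : N) :
    chartSymmDeriv p (extChartAt 𝓘(ℝ, E) p p) = ContinuousLinearMap.id ℝ E :=
  mfderivWithin_range_extChartAt_symm (I := 𝓘(ℝ, E)) (x := p)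

/-- The derivatives of a chart and of its inverse are mutually inverse, so the `inverse` in the
definition of the pull-back is `chartDeriv`. -/
lemma mpullbackWithin_eq_chartField (X : (p : N) → TangentSpace 𝓘(ℝ, E) p) {p : N} {x : E}
    (hx : x ∈ (extChartAt 𝓘(ℝ, E) p).target) :
    (VectorField.mpullbackWithin 𝓘(ℝ, E) 𝓘(ℝ, E) (extChartAt 𝓘(ℝ, E) p).symm X
      (Set.range 𝓘(ℝ, E)) x : E) = chartField X p x := by
  have h1 := mfderivWithin_extChartAt_symm_comp_mfderiv_extChartAt (I := 𝓘(ℝ, E)) hx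
  have h2 := mfderiv_extChartAt_comp_mfderivWithin_extChartAt_symm (I := 𝓘(ℝ, E)) hx
  have h3 := ContinuousLinearMap.inverse_eq h1 h2
  exact congrArg (fun L : E →L[ℝ] E => L (X ((extChartAt 𝓘(ℝ, E) p).symm x) : E)) h3

/-- The manifold bracket is the bracket in the chart, carried back by the inverse derivative of the
chart; at the centre of the chart this derivative is the identity. -/
lemma mlieBracket_eq_lieBracket_chartField (X Y : (p : N) → TangentSpace 𝓘(ℝ, E) p) (p : N) :
    (VectorField.mlieBracket 𝓘(ℝ, E) X Y p : E) =
      VectorField.lieBracket ℝ (chartField X p) (chartField Y p) (extChartAt 𝓘(ℝ, E) p p) := by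
  have hev : ∀ Z : (p : N) → TangentSpace 𝓘(ℝ, E) p,
      (VectorField.mpullbackWithin 𝓘(ℝ, E) 𝓘(ℝ, E) (extChartAt 𝓘(ℝ, E) p).symm Z
        (Set.range 𝓘(ℝ, E)) : E → E) =ᶠ[𝓝 (extChartAt 𝓘(ℝ, E) p p)] chartField Z p := by
    intro Z
    filter_upwards [extChartAt_target_mem_nhds_self p] with x hx
    exact mpullbackWithin_eq_chartField Z hx
  rw [← (hev X).lieBracket_vectorField_eq (hev Y)]
  have h1 : (mfderiv 𝓘(ℝ, E) 𝓘(ℝ, E) (extChartAt 𝓘(ℝ, E) p) p).inverse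
      = (ContinuousLinearMap.id ℝ E) := by
    have h := mfderiv_extChartAt_self (I := 𝓘(ℝ, E)) (x := p)
    rw [h]
    exact ContinuousLinearMap.inverse_id
  have h2 : (extChartAt 𝓘(ℝ, E) p).symm ⁻¹' Set.univ ∩ Set.range 𝓘(ℝ, E) = Set.univ := by simp
  refine (congrArg (fun L : E →L[ℝ] E => L _) h1).trans ?_
  refine Eq.trans (b := VectorField.lieBracketWithin ℝ (E := E) _ _ Set.univ
    (extChartAt 𝓘(ℝ, E) p p)) (congrArg (fun s => VectorField.lieBracketWithin ℝ (E := E) _ _ s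
    (extChartAt 𝓘(ℝ, E) p p)) h2) ?_
  exact congrFun VectorField.lieBracketWithin_univ _

lemma chartField_differentiableAt [FiniteDimensional ℝ E] {X : (p : N) → TangentSpace 𝓘(ℝ, E) p}
    {p : N} (hX : MDifferentiableAt 𝓘(ℝ, E) (𝓘(ℝ, E).prod 𝓘(ℝ, E))
      (fun x => (⟨x, X x⟩ : TangentBundle 𝓘(ℝ, E) N)) p) :
    DifferentiableAt ℝ (chartField X p) (extChartAt 𝓘(ℝ, E) p p) := by
  have h : DifferentiableWithinAt ℝ (E := E) (F := E) _ _ _ := (mdifferentiableWithinAt_univ.2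
    hX).differentiableWithinAt_mpullbackWithin_vectorField
  have h2 : (extChartAt 𝓘(ℝ, E) p).symm ⁻¹' Set.univ ∩ Set.range 𝓘(ℝ, E) = Set.univ := by simp
  rw [h2] at h
  refine (differentiableWithinAt_univ.1 h).congr_of_eventuallyEq ?_
  filter_upwards [extChartAt_target_mem_nhds_self p] with x hx
  exact (mpullbackWithin_eq_chartField X hx).symm

/-- These are the fields with constant coefficients in the chart. They extend a given tangent vector
and serve to test the smoothness of one-forms. -/
lemma smoothFieldOn_chartSymmDeriv (p : N) (w : E) :
    SmoothFieldOn (fun q => (chartSymmDeriv p (extChartAt 𝓘(ℝ, E) p q) w : E))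
      (chartAt E p).source := by
  have hb : (trivializationAt E (TangentSpace 𝓘(ℝ, E)) p).baseSet = (chartAt E p).source :=
    TangentBundle.trivializationAt_baseSet p
  have h := (trivializationAt E (TangentSpace 𝓘(ℝ, E) : N → Type _)
    p).contMDiffOn_section_baseSet_iff (IB := 𝓘(ℝ, E)) (n := ∞)
    (E := (TangentSpace 𝓘(ℝ, E) : N → Type _)) (s := fun q =>
      (show TangentSpace 𝓘(ℝ, E) q from chartSymmDeriv p (extChartAt 𝓘(ℝ, E) p q) w))
  rw [hb] at h
  refine h.2 ((contMDiffOn_const (c := w)).congr fun q hq => ?_)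
  have h1 := TangentBundle.symmL_trivializationAt (I := 𝓘(ℝ, E)) hq
  have h2 : (show TangentSpace 𝓘(ℝ, E) q from chartSymmDeriv p (extChartAt 𝓘(ℝ, E) p q) w) =
      (trivializationAt E (TangentSpace 𝓘(ℝ, E)) p).symmL ℝ q w :=
    congrArg (fun L : E →L[ℝ] TangentSpace 𝓘(ℝ, E) q => L w) h1.symm
  have hq' : q ∈ (trivializationAt E (TangentSpace 𝓘(ℝ, E)) p).baseSet := hb ▸ hq
  have h3 := (trivializationAt E (TangentSpace 𝓘(ℝ, E)) p).apply_mk_symm hq' w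
  refine (congrArg (fun v : TangentSpace 𝓘(ℝ, E) q =>
    ((trivializationAt E (TangentSpace 𝓘(ℝ, E)) p) ⟨q, v⟩).2) h2).trans ?_
  rw [Bundle.Trivialization.symmL_apply _ hq']
  exact congrArg Prod.snd h3

/-- Smoothness of `θ` is only assumed on vector fields. In finite dimension it is enough to test
`chartForm` on constant vectors, that is, `θ` on the coordinate fields. -/
lemma chartForm_differentiableAt [FiniteDimensional ℝ E]
    {θ : (p : N) → TangentSpace 𝓘(ℝ, E) p →ₗ[ℝ] F}
    (hθ : ∀ (W : Set N), IsOpen W → ∀ X : (p : N) → TangentSpace 𝓘(ℝ, E) p, SmoothFieldOn X W →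
      ContMDiffOn 𝓘(ℝ, E) 𝓘(ℝ, F) ∞ (fun p => θ p (X p)) W) (p : N) :
    DifferentiableAt ℝ (chartForm θ p) (extChartAt 𝓘(ℝ, E) p p) := by
  have key : ContDiffOn ℝ ∞ (chartForm θ p) (extChartAt 𝓘(ℝ, E) p).target := by
    refine contDiffOn_clm_apply.2 fun w => ?_
    have h1 := hθ _ (chartAt E p).open_source _ (smoothFieldOn_chartSymmDeriv p w)
    have h2 := (h1.comp (contMDiffOn_extChartAt_symm (n := ∞) (I := 𝓘(ℝ, E)) p)
      (t := (chartAt E p).source) (fun x hx => by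
        have := (extChartAt 𝓘(ℝ, E) p).map_target hx
        rwa [extChartAt_source] at this)).contDiffOn
    refine h2.congr fun x hx => ?_
    have h3 := (extChartAt 𝓘(ℝ, E) p).right_inv hx
    simp only [Function.comp_apply]
    rw [h3]
    rfl
  exact (key.contDiffAt (extChartAt_target_mem_nhds_self p)).differentiableAt (by simp)

lemma chartForm_apply [FiniteDimensional ℝ E] (θ : (p : N) → TangentSpace 𝓘(ℝ, E) p →ₗ[ℝ] F)
    {p q : N} (hq : q ∈ (extChartAt 𝓘(ℝ, E) p).source) (w : E) :
    chartForm θ p (extChartAt 𝓘(ℝ, E) p q) (chartDeriv p q w) = θ q w := by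
  have h := (extChartAt 𝓘(ℝ, E) p).left_inv hq
  have h1 := chartSymmDeriv_chartDeriv ((extChartAt 𝓘(ℝ, E) p).map_source hq) w
  -- The point is generalized to `q'` because the type of `θ q` depends on it and forbids rewriting.
  have h2 : ∀ q' : N, (extChartAt 𝓘(ℝ, E) p).symm (extChartAt 𝓘(ℝ, E) p q) = q' →
      chartForm θ p (extChartAt 𝓘(ℝ, E) p q) (chartDeriv p q' w) = θ q' w := by
    rintro _ rfl
    exact congrArg (fun u : E => θ ((extChartAt 𝓘(ℝ, E) p).symm (extChartAt 𝓘(ℝ, E) p q)) u) h1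
  exact h2 q h

lemma chartField_self (X : (p : N) → TangentSpace 𝓘(ℝ, E) p) (p : N) :
    chartField X p (extChartAt 𝓘(ℝ, E) p p) = X p := by
  rw [chartField_apply X (mem_extChartAt_source p), chartDeriv_self]
  rfl

lemma chartForm_self [FiniteDimensional ℝ E] (θ : (p : N) → TangentSpace 𝓘(ℝ, E) p →ₗ[ℝ] F)
    (p : N) (w : E) : chartForm θ p (extChartAt 𝓘(ℝ, E) p p) w = θ p w := by
  have h := chartForm_apply θ (mem_extChartAt_source p) w
  rw [chartDeriv_self] at h
  exact h

lemma hasMFDerivAt_of_eq_comp_chart {f : N → F} {D : E → F} {p : N}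
    (hf : f =ᶠ[𝓝 p] D ∘ extChartAt 𝓘(ℝ, E) p) (hD : DifferentiableAt ℝ D (extChartAt 𝓘(ℝ, E) p p)) :
    HasMFDerivAt 𝓘(ℝ, E) 𝓘(ℝ, F) f p (fderiv ℝ D (extChartAt 𝓘(ℝ, E) p p) : E →L[ℝ] F) := by
  have h1 : HasMFDerivAt 𝓘(ℝ, E) 𝓘(ℝ, E) (extChartAt 𝓘(ℝ, E) p) p
      (ContinuousLinearMap.id ℝ E) := by
    have h := (mdifferentiableAt_extChartAt (I := 𝓘(ℝ, E)) (mem_chart_source E p)).hasMFDerivAt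
    rw [mfderiv_extChartAt_self] at h
    exact h
  have h2 := hD.hasFDerivAt.hasMFDerivAt.comp p h1
  exact (h2.congr_of_eventuallyEq hf)

variable {E' : Type*} [NormedAddCommGroup E'] [NormedSpace ℝ E']
  {N' : Type*} [TopologicalSpace N'] [ChartedSpace E' N'] [IsManifold 𝓘(ℝ, E') ∞ N']

/-- The source chart is centred at `p` and has the identity as derivative there; the target chart is
centred elsewhere and contributes its derivative. -/
lemma hasFDerivAt_writtenInCharts {f : N → N'} {p : N} {p' : N'}
    (hf : MDifferentiableAt 𝓘(ℝ, E) 𝓘(ℝ, E') f p) (hp' : f p ∈ (extChartAt 𝓘(ℝ, E') p').source) :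
    HasFDerivAt (fun x => extChartAt 𝓘(ℝ, E') p' (f ((extChartAt 𝓘(ℝ, E) p).symm x)))
      ((chartDeriv (E := E') p' (f p)).comp (modelDeriv (E := E) (E' := E') f p))
      (extChartAt 𝓘(ℝ, E) p p) := by
  have h1 : HasMFDerivAt 𝓘(ℝ, E) 𝓘(ℝ, E) (extChartAt 𝓘(ℝ, E) p).symm (extChartAt 𝓘(ℝ, E) p p)
      (ContinuousLinearMap.id ℝ E) := by
    have h := (mdifferentiableWithinAt_extChartAt_symm (I := 𝓘(ℝ, E))
      (mem_extChartAt_target p)).hasMFDerivWithinAt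
    rw [mfderivWithin_range_extChartAt_symm] at h
    simp only [modelWithCornersSelf_coe, Set.range_id] at h
    exact hasMFDerivWithinAt_univ.1 h
  have he : (extChartAt 𝓘(ℝ, E) p).symm (extChartAt 𝓘(ℝ, E) p p) = p := extChartAt_to_inv p
  rw [extChartAt_source] at hp'
  have h2 : HasMFDerivAt 𝓘(ℝ, E) 𝓘(ℝ, E') (extChartAt 𝓘(ℝ, E') p' ∘ f) p
      ((chartDeriv (E := E') p' (f p)).comp (modelDeriv (E := E) (E' := E') f p)) :=
    (mdifferentiableAt_extChartAt (I := 𝓘(ℝ, E')) hp').hasMFDerivAt.comp p hf.hasMFDerivAt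
  have h3 : ∀ q, q = p → HasMFDerivAt 𝓘(ℝ, E) 𝓘(ℝ, E') (extChartAt 𝓘(ℝ, E') p' ∘ f) q
      ((chartDeriv (E := E') p' (f p)).comp (modelDeriv (E := E) (E' := E') f p)) := by
    rintro _ rfl
    exact h2
  exact ((h3 _ he).comp _ h1).hasFDerivAt

/-- Let `G` operate on `P` on the right. The derivative in `g` of the pull-back of a one-form `θ`
by the operation of `g` is the Lie derivative of `θ` along the fundamental vector field. -/
theorem mfderiv_pullback_act {P G : Type*} [TopologicalSpace P] [ChartedSpace E P]
    [IsManifold 𝓘(ℝ, E) ∞ P] [TopologicalSpace G] [ChartedSpace E' G] [IsManifold 𝓘(ℝ, E') ∞ G]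
    [FiniteDimensional ℝ E] {act : P → G → P}
    (hact : ContMDiff (𝓘(ℝ, E).prod 𝓘(ℝ, E')) 𝓘(ℝ, E) ∞ (fun z : P × G => act z.1 z.2))
    (e : G) (hid : ∀ p, act p e = p)
    {θ : (p : P) → TangentSpace 𝓘(ℝ, E) p →ₗ[ℝ] F}
    (hθ : ∀ (W : Set P), IsOpen W → ∀ X : (p : P) → TangentSpace 𝓘(ℝ, E) p, SmoothFieldOn X W →
      ContMDiffOn 𝓘(ℝ, E) 𝓘(ℝ, F) ∞ (fun p => θ p (X p)) W)
    {Y : (p : P) → TangentSpace 𝓘(ℝ, E) p} {p : P}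
    (hY : MDifferentiableAt 𝓘(ℝ, E) (𝓘(ℝ, E).prod 𝓘(ℝ, E))
      (fun x => (⟨x, Y x⟩ : TangentBundle 𝓘(ℝ, E) P)) p) (ξ : E') :
    modelDeriv (E := E') (E' := F) (fun g => θ (act p g)
      (modelDeriv (E := E) (E' := E) (fun q => act q g) p (Y p))) e ξ =
    modelDeriv (E := E) (E' := F) (fun q => θ q (Y q)) p
      (modelDeriv (E := E') (E' := E) (fun g => act p g) e ξ) -
    θ p (VectorField.mlieBracket 𝓘(ℝ, E)
      (fun q => (modelDeriv (E := E') (E' := E) (fun g => act q g) e ξ)) Y p) := by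
  set φ := extChartAt 𝓘(ℝ, E) p with hφ
  set ψ := extChartAt 𝓘(ℝ, E') e with hψ
  have actL : ∀ g, ContMDiff 𝓘(ℝ, E) 𝓘(ℝ, E) ∞ (fun q => act q g) := fun g =>
    hact.comp (contMDiff_id.prodMk contMDiff_const)
  have actR : ∀ q, ContMDiff 𝓘(ℝ, E') 𝓘(ℝ, E) ∞ (fun g => act q g) := fun q =>
    hact.comp (contMDiff_const.prodMk contMDiff_id)
  have hφ0 : φ.symm (φ p) = p := extChartAt_to_inv p
  have hψ0 : ψ.symm (ψ e) = e := extChartAt_to_inv e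
  -- The operation in the charts centred at `p` and `e`: a family of maps that is the identity at
  -- the parameter `ψ e`.
  let Φ : E × E' → E := fun z => φ (act (φ.symm z.1) (ψ.symm z.2))
  have hΦ : ContDiffAt ℝ 2 Φ (φ p, ψ e) := by
    have h1 : ContMDiffAt 𝓘(ℝ, E × E') 𝓘(ℝ, E) ∞ (fun z : E × E' => φ.symm z.1) (φ p, ψ e) :=
      ((contMDiffOn_extChartAt_symm p).contMDiffAt (extChartAt_target_mem_nhds_self p)).comp
        (φ p, ψ e) (contDiff_fst.contMDiff.contMDiffAt (x := (φ p, ψ e)))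
    have h2 : ContMDiffAt 𝓘(ℝ, E × E') 𝓘(ℝ, E') ∞ (fun z : E × E' => ψ.symm z.2) (φ p, ψ e) :=
      ((contMDiffOn_extChartAt_symm e).contMDiffAt (extChartAt_target_mem_nhds_self e)).comp
        (φ p, ψ e) (contDiff_snd.contMDiff.contMDiffAt (x := (φ p, ψ e)))
    have h3 := hact.contMDiffAt.comp (φ p, ψ e) (h1.prodMk h2)
    have h4 : ContMDiffAt 𝓘(ℝ, E) 𝓘(ℝ, E) ∞ φ (act (φ.symm (φ p)) (ψ.symm (ψ e))) := by
      rw [hψ0, hid, hφ0]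
      exact contMDiffAt_extChartAt
    exact ((h4.comp (φ p, ψ e) h3).contDiffAt).of_le ENat.LEInfty.out
  have hid' : ∀ᶠ x in 𝓝 (φ p), Φ (x, ψ e) = x := by
    filter_upwards [extChartAt_target_mem_nhds_self p] with x hx
    simp only [Φ, hψ0, hid]
    exact φ.right_inv hx
  have hV : ∀ᶠ x in 𝓝 (φ p), chartField
      (fun q => (modelDeriv (E := E') (E' := E) (fun g => act q g) e ξ)) p x =
        fderiv ℝ (fun z => Φ (x, z)) (ψ e) ξ := by
    filter_upwards [extChartAt_target_mem_nhds_self p] with x hx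
    have hs : act (φ.symm x) e ∈ (extChartAt 𝓘(ℝ, E) p).source := by
      rw [hid]; exact φ.map_target hx
    have h := hasFDerivAt_writtenInCharts
      ((actR (φ.symm x)).mdifferentiableAt (x := e) (by simp)) hs
    rw [h.fderiv, hid]
    rfl
  obtain ⟨hd, hk⟩ := hasFDerivAt_pullback_family hΦ hid' (chartForm_differentiableAt hθ p)
    (chartField_differentiableAt hY) hV
  have hG : (fun g => θ (act p g) (modelDeriv (E := E) (E' := E) (fun q => act q g) p (Y p)))
      =ᶠ[𝓝 e] (fun z => chartForm θ p (Φ (φ p, z))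
        (fderiv ℝ (fun x => Φ (x, z)) (φ p) (chartField Y p (φ p)))) ∘ ψ := by
    -- Reading the pull-back in the chart at `p` requires `p · g` to stay in its domain, which holds
    -- for `g` near `e`.
    have hsrc : ∀ᶠ g in 𝓝 e, act p g ∈ (extChartAt 𝓘(ℝ, E) p).source := by
      refine (actR p).continuous.continuousAt.eventually_mem ?_
      rw [hid]
      exact extChartAt_source_mem_nhds p
    filter_upwards [hsrc, extChartAt_source_mem_nhds (I := 𝓘(ℝ, E')) e] with g hg hg'
    have hψg : ψ.symm (ψ g) = g := ψ.left_inv hg'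
    have h := hasFDerivAt_writtenInCharts
      ((actL g).mdifferentiableAt (x := p) (by simp)) hg
    simp only [Function.comp_apply, Φ, hψg, hφ0]
    rw [h.fderiv, chartField_self]
    exact (chartForm_apply θ hg _).symm
  have hP : (fun q => θ q (Y q)) =ᶠ[𝓝 p] (fun x => chartForm θ p x (chartField Y p x)) ∘ φ := by
    filter_upwards [extChartAt_source_mem_nhds (I := 𝓘(ℝ, E)) p] with q hq
    simp only [Function.comp_apply]
    rw [chartField_apply Y hq]
    exact (chartForm_apply θ hq _).symm
  have e1 : modelDeriv (E := E') (E' := F) _ e = _ := (hasMFDerivAt_of_eq_comp_chart hG hd).mfderiv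
  have e2 : modelDeriv (E := E) (E' := F) _ p = _ := (hasMFDerivAt_of_eq_comp_chart hP ((chartForm_differentiableAt hθ p).clm_apply
    (chartField_differentiableAt hY))).mfderiv
  rw [e1, e2]
  refine hk.trans ?_
  exact congrArg₂ (· - ·)
    (congrArg (fderiv ℝ (fun x => chartForm θ p x (chartField Y p x)) (φ p)) (chartField_self _ p))
    ((chartForm_self θ p _).trans
      (congrArg (θ p) (mlieBracket_eq_lieBracket_chartField _ Y p).symm))

end Chart

/-! ### The chain rule -/

section ChainRule

variable {E₁ N₁ E₂ N₂ E₃ N₃ : Type*} [NormedAddCommGroup E₁] [NormedSpace ℝ E₁]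
  [TopologicalSpace N₁] [ChartedSpace E₁ N₁] [NormedAddCommGroup E₂] [NormedSpace ℝ E₂]
  [TopologicalSpace N₂] [ChartedSpace E₂ N₂] [NormedAddCommGroup E₃] [NormedSpace ℝ E₃]
  [TopologicalSpace N₃] [ChartedSpace E₃ N₃]

lemma modelDeriv_comp {g : N₂ → N₃} {f : N₁ → N₂} {h : N₁ → N₃} {p : N₁} {q : N₂}
    (hh : ∀ᶠ x in 𝓝 p, h x = g (f x))
    (hq : f p = q) (hg : MDifferentiableAt 𝓘(ℝ, E₂) 𝓘(ℝ, E₃) g q)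
    (hf : MDifferentiableAt 𝓘(ℝ, E₁) 𝓘(ℝ, E₂) f p) (v : E₁) :
    modelDeriv (E := E₁) (E' := E₃) h p v =
      modelDeriv (E := E₂) (E' := E₃) g q (modelDeriv (E := E₁) (E' := E₂) f p v) := by
  subst hq
  have h1 : mfderiv 𝓘(ℝ, E₁) 𝓘(ℝ, E₃) h p = mfderiv 𝓘(ℝ, E₁) 𝓘(ℝ, E₃) (g ∘ f) p :=
    Filter.EventuallyEq.mfderiv_eq hh
  exact congrArg (fun L : E₁ →L[ℝ] E₃ => L v) (h1.trans (mfderiv_comp p hg hf))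

lemma modelDeriv_of_eventually_eq_self {h : N₁ → N₁} {p : N₁} (hh : ∀ᶠ x in 𝓝 p, h x = x)
    (v : E₁) : modelDeriv (E := E₁) (E' := E₁) h p v = v := by
  have h1 : mfderiv 𝓘(ℝ, E₁) 𝓘(ℝ, E₁) h p = mfderiv 𝓘(ℝ, E₁) 𝓘(ℝ, E₁) id p :=
    Filter.EventuallyEq.mfderiv_eq hh
  exact congrArg (fun L : E₁ →L[ℝ] E₁ => L v) (h1.trans mfderiv_id)

end ChainRule

/-! ### Smoothness of maps into tangent bundles -/

section TangentMaps

variable {EQ HQ : Type*} [NormedAddCommGroup EQ] [NormedSpace ℝ EQ] [TopologicalSpace HQ]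
  {IQ : ModelWithCorners ℝ EQ HQ} {Q : Type*} [TopologicalSpace Q] [ChartedSpace HQ Q]
  {E₁ H₁ : Type*} [NormedAddCommGroup E₁] [NormedSpace ℝ E₁] [TopologicalSpace H₁]
  {I₁ : ModelWithCorners ℝ E₁ H₁} {N₁ : Type*} [TopologicalSpace N₁] [ChartedSpace H₁ N₁]
  [IsManifold I₁ 1 N₁]
  {E₂ H₂ : Type*} [NormedAddCommGroup E₂] [NormedSpace ℝ E₂] [TopologicalSpace H₂]
  {I₂ : ModelWithCorners ℝ E₂ H₂} {N₂ : Type*} [TopologicalSpace N₂] [ChartedSpace H₂ N₂]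
  [IsManifold I₂ 1 N₂]
  {E₃ H₃ : Type*} [NormedAddCommGroup E₃] [NormedSpace ℝ E₃] [TopologicalSpace H₃]
  {I₃ : ModelWithCorners ℝ E₃ H₃} {N₃ : Type*} [TopologicalSpace N₃] [ChartedSpace H₃ N₃]
  [IsManifold I₃ 1 N₃]

/-- Composition with the tangent map of `f`. Vectors along a map `b`, rather than vector fields, are
needed because fields on `P` are built from data on `M` and `G`. -/
lemma contMDiffOn_mfderiv_comp {f : N₁ → N₂} {U : Set N₁} (hU : IsOpen U)
    (hf : ContMDiffOn I₁ I₂ ∞ f U) {s : Set Q} {b : Q → N₁} {v : (q : Q) → TangentSpace I₁ (b q)}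
    (hz : ContMDiffOn IQ I₁.tangent ∞ (fun q => (⟨b q, v q⟩ : TangentBundle I₁ N₁)) s)
    (hb : ∀ q ∈ s, b q ∈ U) :
    ContMDiffOn IQ I₂.tangent ∞
      (fun q => (⟨f (b q), mfderiv I₁ I₂ f (b q) (v q)⟩ : TangentBundle I₂ N₂)) s := by
  have h := (hf.contMDiffOn_tangentMapWithin (m := ∞) (by simp) hU.uniqueMDiffOn).comp hz
    (fun q hq => hb q hq)
  refine h.congr fun q hq => ?_
  simp only [Function.comp_apply, tangentMapWithin, mfderivWithin_of_isOpen hU (hb q hq)]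

lemma contMDiffOn_mfderiv_comp_prod {f : N₁ × N₂ → N₃} {U : Set (N₁ × N₂)} (hU : IsOpen U)
    (hf : ContMDiffOn (I₁.prod I₂) I₃ ∞ f U) {s : Set Q}
    {b₁ : Q → N₁} {v₁ : (q : Q) → TangentSpace I₁ (b₁ q)}
    {b₂ : Q → N₂} {v₂ : (q : Q) → TangentSpace I₂ (b₂ q)}
    (h₁ : ContMDiffOn IQ I₁.tangent ∞ (fun q => (⟨b₁ q, v₁ q⟩ : TangentBundle I₁ N₁)) s)
    (h₂ : ContMDiffOn IQ I₂.tangent ∞ (fun q => (⟨b₂ q, v₂ q⟩ : TangentBundle I₂ N₂)) s)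
    (hb : ∀ q ∈ s, (b₁ q, b₂ q) ∈ U) :
    ContMDiffOn IQ I₃.tangent ∞
      (fun q => (⟨f (b₁ q, b₂ q), mfderiv I₁ I₃ (fun x => f (x, b₂ q)) (b₁ q) (v₁ q) +
        mfderiv I₂ I₃ (fun y => f (b₁ q, y)) (b₂ q) (v₂ q)⟩ : TangentBundle I₃ N₃)) s := by
  have h12 : ContMDiffOn IQ (I₁.prod I₂).tangent ∞
      (fun q => (⟨(b₁ q, b₂ q), (v₁ q, v₂ q)⟩ : TangentBundle (I₁.prod I₂) (N₁ × N₂))) s :=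
    (contMDiff_equivTangentBundleProd_symm (n := ∞)).comp_contMDiffOn (h₁.prodMk h₂)
  refine (contMDiffOn_mfderiv_comp hU hf h12 hb).congr fun q hq => ?_
  have h := mfderiv_prod_eq_add_apply (I := I₁) (I' := I₂) (I'' := I₃) (f := f) (p := (b₁ q, b₂ q))
    (v := (v₁ q, v₂ q))
    ((hf.contMDiffAt (hU.mem_nhds (hb q hq))).mdifferentiableAt (by simp))
  exact congrArg (Bundle.TotalSpace.mk' E₃ (f (b₁ q, b₂ q))) h.symm

end TangentMaps

/-! ### Smooth maps into a single tangent space. -/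

section ConstantBase

variable {E : Type*} [NormedAddCommGroup E] [NormedSpace ℝ E]
  {N : Type*} [TopologicalSpace N] [ChartedSpace E N]
  {EQ : Type*} [NormedAddCommGroup EQ] [NormedSpace ℝ EQ]
  {HQ : Type*} [TopologicalSpace HQ] {IQ : ModelWithCorners ℝ EQ HQ}
  {Q : Type*} [TopologicalSpace Q] [ChartedSpace HQ Q]

lemma tangentBundle_mk_congr {n n' : N} (h : n = n') {v v' : E} (hv : v = v') :
    (⟨n, v⟩ : TangentBundle 𝓘(ℝ, E) N) = ⟨n', v'⟩ := by
  subst h hv; rfl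

variable [IsManifold 𝓘(ℝ, E) ∞ N]

lemma trivializationAt_self_snd (n : N) (v : E) :
    (trivializationAt E (TangentSpace 𝓘(ℝ, E)) n (⟨n, v⟩ : TangentBundle 𝓘(ℝ, E) N)).2 = v := by
  rw [TangentBundle.trivializationAt_apply]
  exact tangentCoordChange_self (I := 𝓘(ℝ, E)) (mem_extChartAt_source n)

/-- Passes between `𝔤`-valued functions and maps to the tangent bundle of `G` over `1`, so that
smoothness of tangent maps yields smoothness of `𝔤`-valued expressions. -/
lemma contMDiffOn_tangent_const_iff {s : Set Q} (n : N) (v : Q → E) :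
    ContMDiffOn IQ (𝓘(ℝ, E).prod 𝓘(ℝ, E)) ∞ (fun q => (⟨n, v q⟩ : TangentBundle 𝓘(ℝ, E) N)) s ↔
      ContMDiffOn IQ 𝓘(ℝ, E) ∞ v s := by
  refine forall₂_congr fun q _ => ?_
  rw [Bundle.contMDiffWithinAt_totalSpace]
  have h : (fun q => (trivializationAt E (TangentSpace 𝓘(ℝ, E)) n
      (⟨n, v q⟩ : TangentBundle 𝓘(ℝ, E) N)).2) = v := funext fun q => trivializationAt_self_snd n _
  exact ⟨fun h' => h ▸ h'.2, fun h' => ⟨contMDiffWithinAt_const, h.symm ▸ h'⟩⟩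

end ConstantBase

/-! ### The adjoint representation -/

section Adjoint

variable {EG : Type*} [NormedAddCommGroup EG] [NormedSpace ℝ EG] 
  {G : Type*} [TopologicalSpace G] [ChartedSpace EG G] [Group G]
  {EQ : Type*} [NormedAddCommGroup EQ] [NormedSpace ℝ EQ]
  {HQ : Type*} [TopologicalSpace HQ] {IQ : ModelWithCorners ℝ EQ HQ}
  {Q : Type*} [TopologicalSpace Q] [ChartedSpace HQ Q]

lemma Ad_one (ξ : LieAlg EG G) : Ad (1 : G) ξ = ξ :=
  modelDeriv_of_eventually_eq_self (E₁ := EG) (.of_forall fun k => by simp) ξ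

variable [LieGroup 𝓘(ℝ, EG) ∞ G]

lemma contMDiff_conj : ContMDiff (𝓘(ℝ, EG).prod 𝓘(ℝ, EG)) 𝓘(ℝ, EG) ∞
    (fun z : G × G => z.1 * z.2 * z.1⁻¹) :=
  (contMDiff_fst.mul contMDiff_snd).mul contMDiff_fst.inv

instance instIsManifoldLieGroup : IsManifold 𝓘(ℝ, EG) ∞ G := LieGroup.toContMDiffMul.toIsManifold

/-- `Ad_k γ` is the tangent map of `(g, h) ↦ g h g⁻¹` applied to the zero vector at `k` and to `γ`
at `1`. -/
lemma contMDiffOn_Ad {s : Set Q} {k : Q → G} {γ : Q → LieAlg EG G}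
    (hk : ContMDiffOn IQ 𝓘(ℝ, EG) ∞ k s) (hγ : ContMDiffOn IQ 𝓘(ℝ, EG) ∞ (M' := EG) γ s) :
    ContMDiffOn IQ 𝓘(ℝ, EG) ∞ (M' := EG) (fun q => Ad (k q) (γ q)) s := by
  replace hγ := (contMDiffOn_tangent_const_iff (E := EG) (1 : G) γ).2 hγ
  refine (contMDiffOn_tangent_const_iff (E := EG) (1 : G) _).1 ?_
  have h0 : ContMDiffOn IQ (𝓘(ℝ, EG).prod 𝓘(ℝ, EG)) ∞
      (fun q => (⟨k q, 0⟩ : TangentBundle 𝓘(ℝ, EG) G)) s :=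
    (Bundle.contMDiff_zeroSection ℝ (TangentSpace 𝓘(ℝ, EG) : G → Type _)).comp_contMDiffOn hk
  refine (contMDiffOn_mfderiv_comp_prod isOpen_univ (contMDiff_conj (G := G)).contMDiffOn h0 hγ
    (fun _ _ => Set.mem_univ _)).congr fun q _ => ?_
  refine tangentBundle_mk_congr (by simp) ?_
  rw [map_zero, zero_add]
  rfl

lemma mdifferentiableAt_conj (g h : G) :
    MDifferentiableAt 𝓘(ℝ, EG) 𝓘(ℝ, EG) (fun h : G => g * h * g⁻¹) h :=
  ((contMDiff_conj (EG := EG) (G := G)).comp (contMDiff_const.prodMk contMDiff_id)).mdifferentiableAt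
    (by simp)

lemma Ad_mul (g h : G) (ξ : LieAlg EG G) : Ad (g * h) ξ = Ad g (Ad h ξ) :=
  modelDeriv_comp (E₁ := EG) (E₂ := EG) (E₃ := EG) (g := fun k : G => g * k * g⁻¹)
    (f := fun k : G => h * k * h⁻¹) (.of_forall fun k => by group) (by simp)
    (mdifferentiableAt_conj g 1) (mdifferentiableAt_conj h 1) ξ

lemma mdifferentiableAt_mul_left (g h : G) :
    MDifferentiableAt 𝓘(ℝ, EG) 𝓘(ℝ, EG) (fun k : G => g * k) h :=
  (contMDiff_mul_left (I := 𝓘(ℝ, EG)) (n := ∞)).mdifferentiableAt (by simp)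

lemma mdifferentiableAt_mul_right (g h : G) :
    MDifferentiableAt 𝓘(ℝ, EG) 𝓘(ℝ, EG) (fun k : G => k * g) h :=
  (contMDiff_mul_right (I := 𝓘(ℝ, EG)) (n := ∞)).mdifferentiableAt (by simp)

variable (EG) in
/-- The Maurer–Cartan form `T_g G → 𝔤` of a Lie group. -/
def maurerCartan (g : G) : TangentSpace 𝓘(ℝ, EG) g →ₗ[ℝ] EG :=
  (modelDeriv (E := EG) (E' := EG) (fun h => g⁻¹ * h) g).toLinearMap

lemma contMDiffOn_maurerCartan (W : Set G) (X : (g : G) → TangentSpace 𝓘(ℝ, EG) g)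
    (hX : SmoothFieldOn X W) :
    ContMDiffOn 𝓘(ℝ, EG) 𝓘(ℝ, EG) ∞ (fun g => maurerCartan EG g (X g)) W := by
  refine (contMDiffOn_tangent_const_iff (E := EG) (1 : G) _).1 ?_
  have h0 : ContMDiffOn 𝓘(ℝ, EG) (𝓘(ℝ, EG).prod 𝓘(ℝ, EG)) ∞
      (fun g => (⟨g⁻¹, 0⟩ : TangentBundle 𝓘(ℝ, EG) G)) W :=
    (Bundle.contMDiff_zeroSection ℝ (TangentSpace 𝓘(ℝ, EG) : G → Type _)).comp_contMDiffOn
      (contMDiff_inv 𝓘(ℝ, EG) ∞).contMDiffOn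
  refine (contMDiffOn_mfderiv_comp_prod isOpen_univ
    (contMDiff_mul (G := G) 𝓘(ℝ, EG) ∞).contMDiffOn h0 hX
    (fun _ _ => Set.mem_univ _)).congr fun q _ => ?_
  refine tangentBundle_mk_congr (by simp) ?_
  rw [map_zero, zero_add]
  rfl

/-- The derivative at `1` of the adjoint representation. -/
theorem modelDeriv_Ad_inv [FiniteDimensional ℝ EG] (ξ η : LieAlg EG G) :
    modelDeriv (E := EG) (E' := EG) (N' := EG) (fun g : G => (Ad g⁻¹ η : LieAlg EG G)) 1 ξ =
      -⁅ξ, η⁆ := by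
  have hY := mdifferentiableAt_mulInvariantVectorField (I := 𝓘(ℝ, EG)) η (g := (1 : G))
  -- `G` operates on itself by right translations, `θ` is the Maurer–Cartan form and the field is
  -- left-invariant with value `η`. The pulled-back value at `1` is then `Ad_{g⁻¹} η`.
  have key := mfderiv_pullback_act (E := EG) (E' := EG) (F := EG) (P := G) (G := G)
    (act := fun g h => g * h) (contMDiff_mul 𝓘(ℝ, EG) ∞) 1 mul_one (θ := maurerCartan EG)
    (fun W _ X hX => contMDiffOn_maurerCartan W X hX) hY ξ
  have hY1 : (mulInvariantVectorField (I := 𝓘(ℝ, EG)) η (1 : G) : EG) = η :=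
    modelDeriv_of_eventually_eq_self (E₁ := EG) (.of_forall fun k => by simp) η
  have hL : (fun g : G => maurerCartan EG (1 * g) (modelDeriv (E := EG) (E' := EG)
      (fun q : G => q * g) 1 (mulInvariantVectorField (I := 𝓘(ℝ, EG)) η (1 : G)))) =
      fun g : G => (Ad g⁻¹ η : LieAlg EG G) := by
    funext g
    rw [hY1]
    exact (modelDeriv_comp (E₁ := EG) (E₂ := EG) (E₃ := EG)
      (g := fun k : G => (1 * g)⁻¹ * k) (f := fun k : G => k * g)
      (.of_forall fun k => by group) rfl
      (mdifferentiableAt_mul_left _ _) (mdifferentiableAt_mul_right _ _) η).symm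
  -- The Maurer–Cartan form is constant on a left-invariant field, so only the bracket term
  -- survives.
  have hR : (fun g : G => maurerCartan EG g (mulInvariantVectorField (I := 𝓘(ℝ, EG)) η g)) =
      fun _ : G => η := by
    funext g
    have h1 := modelDeriv_comp (E₁ := EG) (E₂ := EG) (E₃ := EG) (h := fun k : G => k)
      (g := fun k : G => g⁻¹ * k) (f := fun k : G => g * k) (p := 1)
      (.of_forall fun k => by simp) (mul_one g)
      (mdifferentiableAt_mul_left _ _) (mdifferentiableAt_mul_left _ _) η
    exact h1.symm.trans
      (modelDeriv_of_eventually_eq_self (E₁ := EG) (.of_forall fun k => rfl) η)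
  have h0 : modelDeriv (E := EG) (E' := EG) (N' := EG) (fun _ : G => η) 1 = 0 :=
    mfderiv_const (I := 𝓘(ℝ, EG)) (I' := 𝓘(ℝ, EG))
  have h1 : ∀ v : EG, maurerCartan EG (1 : G) v = v := fun v =>
    modelDeriv_of_eventually_eq_self (E₁ := EG) (.of_forall fun k => by simp) v
  rw [hL, hR, h0] at key
  refine key.trans ?_
  rw [zero_apply, zero_sub]
  -- The fundamental fields of right translation are the left-invariant fields, so the remaining
  -- bracket is that of `𝔤` by definition.
  exact congrArg Neg.neg (h1 _)

end Adjoint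

section BundleGeometry

variable {EM EP EG : Type*}
  [NormedAddCommGroup EM] [NormedSpace ℝ EM] [NormedAddCommGroup EP] [NormedSpace ℝ EP]
  [NormedAddCommGroup EG] [NormedSpace ℝ EG]
  {M P G : Type*} [TopologicalSpace M] [ChartedSpace EM M]
  [TopologicalSpace P] [ChartedSpace EP P]
  [TopologicalSpace G] [ChartedSpace EG G] [Group G]
  {B : PrincipalBundle EM EP EG M P G}

/-! ### The operation of the structure group -/

lemma contMDiff_act_left (g : G) : ContMDiff 𝓘(ℝ, EP) 𝓘(ℝ, EP) ∞ (fun p => B.act p g) :=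
  B.smooth_act.comp (contMDiff_id.prodMk contMDiff_const)

lemma contMDiff_act_right (p : P) : ContMDiff 𝓘(ℝ, EG) 𝓘(ℝ, EP) ∞ (fun g => B.act p g) :=
  B.smooth_act.comp (contMDiff_const.prodMk contMDiff_id)

lemma mdifferentiableAt_act_left (g : G) (p : P) :
    MDifferentiableAt 𝓘(ℝ, EP) 𝓘(ℝ, EP) (fun p => B.act p g) p :=
  (contMDiff_act_left g).mdifferentiableAt (by simp)

lemma mdifferentiableAt_act_right (g : G) (p : P) :
    MDifferentiableAt 𝓘(ℝ, EG) 𝓘(ℝ, EP) (fun g => B.act p g) g :=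
  (contMDiff_act_right p).mdifferentiableAt (by simp)

lemma tangentAct_one (p : P) (w : EP) :
    (modelDeriv (E := EP) (E' := EP) (fun p : P => B.act p 1) p w) = w :=
  modelDeriv_of_eventually_eq_self (.of_forall fun q => B.act_one q) w

lemma tangentAct_mul (g h : G) {p p' : P} (hp : B.act p g = p') (w : EP) :
    modelDeriv (E := EP) (E' := EP) (fun p : P => B.act p (g * h)) p w =
      modelDeriv (E := EP) (E' := EP) (fun p : P => B.act p h) p'
        (modelDeriv (E := EP) (E' := EP) (fun p : P => B.act p g) p w) :=
  modelDeriv_comp (.of_forall fun q => B.act_mul q g h) hp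
    (mdifferentiableAt_act_left h p') (mdifferentiableAt_act_left g p) w

/-- Differentiate `(p · k) · g = (p · g) · (g⁻¹ k g)` at `k = 1`. -/
lemma fundamental_act [LieGroup 𝓘(ℝ, EG) ∞ G] (p : P) (g : G) (ξ : LieAlg EG G) :
    fundamental B (B.act p g) (Ad g⁻¹ ξ) = tangentAct B g p (fundamental B p ξ) := by
  have h1 := modelDeriv_comp (E₁ := EG) (E₂ := EG) (E₃ := EP) (p := (1 : G)) (q := 1)
    (h := fun k : G => B.act (B.act p k) g)
    (g := fun k : G => B.act (B.act p g) k) (f := fun k : G => g⁻¹ * k * g⁻¹⁻¹)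
    (.of_forall fun k => by
      rw [← B.act_mul, ← B.act_mul]
      exact congrArg (B.act p) (by group)) (by simp) (mdifferentiableAt_act_right _ _)
    (mdifferentiableAt_conj _ _) ξ
  have h2 := modelDeriv_comp (E₁ := EG) (E₂ := EP) (E₃ := EP) (p := (1 : G)) (q := p)
    (h := fun k : G => B.act (B.act p k) g)
    (g := fun q => B.act q g) (f := fun k : G => B.act p k)
    (.of_forall fun k => rfl) (B.act_one p) (mdifferentiableAt_act_left _ _)
    (mdifferentiableAt_act_right _ _) ξ
  exact h1.symm.trans h2

lemma smoothFieldOn_fundamental [IsManifold 𝓘(ℝ, EP) ∞ P] [LieGroup 𝓘(ℝ, EG) ∞ G] {s : Set P}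
    {v : P → LieAlg EG G}
    (hv : ContMDiffOn 𝓘(ℝ, EP) 𝓘(ℝ, EG) ∞ (M' := EG) v s) :
    SmoothFieldOn (fun p => fundamental B p (v p)) s := by
  replace hv := (contMDiffOn_tangent_const_iff (E := EG) (1 : G) v).2 hv
  have h0 : ContMDiffOn 𝓘(ℝ, EP) (𝓘(ℝ, EP).prod 𝓘(ℝ, EP)) ∞
      (fun p => (⟨p, 0⟩ : TangentBundle 𝓘(ℝ, EP) P)) s :=
    (Bundle.contMDiff_zeroSection ℝ (TangentSpace 𝓘(ℝ, EP) : P → Type _)).contMDiffOn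
  refine (contMDiffOn_mfderiv_comp_prod isOpen_univ B.smooth_act.contMDiffOn h0 hv
    (fun _ _ => Set.mem_univ _)).congr fun q _ => ?_
  refine tangentBundle_mk_congr (B.act_one q).symm ?_
  rw [map_zero, zero_add]
  rfl

/-! ### The local section and the flat connection of a local trivialization -/

namespace LocalTriv

variable (φ : B.Triv)

lemma mem_target {x : M} (hx : x ∈ φ.baseSet) (g : G) : (x, g) ∈ φ.toHomeo.target := by
  rw [φ.target_eq]; exact ⟨hx, Set.mem_univ _⟩

lemma mem_source {p : P} (hp : B.proj p ∈ φ.baseSet) : p ∈ φ.toHomeo.source := by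
  rw [φ.source_eq]; exact hp

lemma toHomeo_sec {x : M} (hx : x ∈ φ.baseSet) : φ.toHomeo (φ.sec x) = (x, 1) :=
  φ.toHomeo.right_inv (φ.mem_target hx 1)

lemma proj_sec {x : M} (hx : x ∈ φ.baseSet) : B.proj (φ.sec x) = x := by
  have h : φ.sec x ∈ φ.toHomeo.source := φ.toHomeo.map_target (φ.mem_target hx 1)
  rw [← φ.fst_eq _ h, φ.toHomeo_sec hx]

lemma toHomeo_act {p : P} (hp : B.proj p ∈ φ.baseSet) (g : G) :
    (φ.toHomeo (B.act p g)).2 = (φ.toHomeo p).2 * g :=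
  φ.snd_act p (φ.mem_source hp) g

lemma symm_eq_act {x : M} (hx : x ∈ φ.baseSet) (g : G) :
    φ.toHomeo.symm (x, g) = B.act (φ.sec x) g := by
  have hs : B.proj (φ.sec x) ∈ φ.baseSet := by rwa [φ.proj_sec hx]
  have hs' : B.proj (B.act (φ.sec x) g) ∈ φ.baseSet := by rwa [B.proj_act]
  have h : φ.toHomeo (B.act (φ.sec x) g) = (x, g) := by
    refine Prod.ext ?_ ?_
    · rw [φ.fst_eq _ (φ.mem_source hs'), B.proj_act, φ.proj_sec hx]
    · rw [φ.toHomeo_act hs, φ.toHomeo_sec hx, one_mul]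
  rw [← h, φ.toHomeo.left_inv (φ.mem_source hs')]

lemma act_sec {p : P} (hp : B.proj p ∈ φ.baseSet) :
    B.act (φ.sec (B.proj p)) (φ.toHomeo p).2 = p := by
  rw [← φ.symm_eq_act hp, ← φ.fst_eq p (φ.mem_source hp)]
  exact φ.toHomeo.left_inv (φ.mem_source hp)

lemma contMDiffOn_sec : ContMDiffOn 𝓘(ℝ, EM) 𝓘(ℝ, EP) ∞ φ.sec φ.baseSet :=
  φ.smooth_invFun.comp (contMDiff_id.prodMk contMDiff_const).contMDiffOn
    (fun _ hx => φ.mem_target hx 1)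

lemma mdifferentiableAt_sec {x : M} (hx : x ∈ φ.baseSet) :
    MDifferentiableAt 𝓘(ℝ, EM) 𝓘(ℝ, EP) φ.sec x :=
  (φ.contMDiffOn_sec.contMDiffAt (φ.isOpen_baseSet.mem_nhds hx)).mdifferentiableAt (by simp)

lemma contMDiffOn_snd : ContMDiffOn 𝓘(ℝ, EP) 𝓘(ℝ, EG) ∞ (fun p => (φ.toHomeo p).2)
    (B.proj ⁻¹' φ.baseSet) := by
  rw [← φ.source_eq]
  exact contMDiff_snd.comp_contMDiffOn φ.smooth_toFun

/-- The invariant vector field `∇⁰_X + ι(Ψ(γ))` over the domain of a local trivialization. -/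
def flatField (X : (x : M) → TangentSpace 𝓘(ℝ, EM) x) (γ : M → LieAlg EG G) (p : P) :
    TangentSpace 𝓘(ℝ, EP) p :=
  φ.nablaZero X p + iota B (φ.Psi γ) p

lemma nablaZero_sec (X : (x : M) → TangentSpace 𝓘(ℝ, EM) x) {x : M} (hx : x ∈ φ.baseSet) :
    φ.nablaZero X (φ.sec x) = mfderiv 𝓘(ℝ, EM) 𝓘(ℝ, EP) φ.sec x (X x) := by
  -- Base point and group element are generalized, since the tangent spaces depend on them.
  have h : ∀ y, y = x → ∀ g : G, g = 1 →
      modelDeriv (E := EP) (E' := EP) (fun p : P => B.act p g) (φ.sec y)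
        (modelDeriv (E := EM) (E' := EP) φ.sec y (X y)) =
      modelDeriv (E := EM) (E' := EP) φ.sec x (X x) := by
    rintro _ rfl _ rfl
    exact tangentAct_one _ _
  exact h _ (φ.proj_sec hx) _ (by rw [φ.toHomeo_sec hx])

/-- The group component of `p · g` is that of `p` times `g`, and `R_{kg} = R_g ∘ R_k`. -/
lemma tangentAct_nablaZero (X : (x : M) → TangentSpace 𝓘(ℝ, EM) x) {p : P}
    (hp : B.proj p ∈ φ.baseSet) (g : G) :
    tangentAct B g p (φ.nablaZero X p) = φ.nablaZero X (B.act p g) := by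
  have h : ∀ y, y = B.proj p → ∀ k : G, k = (φ.toHomeo p).2 * g →
      modelDeriv (E := EP) (E' := EP) (fun p : P => B.act p k) (φ.sec y)
        (modelDeriv (E := EM) (E' := EP) φ.sec y (X y)) = tangentAct B g p (φ.nablaZero X p) := by
    rintro _ rfl _ rfl
    exact tangentAct_mul _ _ (φ.act_sec hp) _
  exact (h _ (B.proj_act p g) _ (φ.toHomeo_act hp g)).symm

lemma Psi_sec (γ : M → LieAlg EG G) {x : M} (hx : x ∈ φ.baseSet) :
    φ.Psi γ (φ.sec x) = γ x := by
  rw [Psi, φ.toHomeo_sec hx, φ.proj_sec hx, inv_one, Ad_one]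

/-- On the section both `R_g` and `Ad_{g⁻¹}` are trivial. The vertical term is the one that cancels
against `v^P` in the correspondence. -/
lemma flatField_sec (X : (x : M) → TangentSpace 𝓘(ℝ, EM) x) (γ : M → LieAlg EG G) {x : M}
    (hx : x ∈ φ.baseSet) : φ.flatField X γ (φ.sec x) =
      mfderiv 𝓘(ℝ, EM) 𝓘(ℝ, EP) φ.sec x (X x) - fundamental B (φ.sec x) (γ x) := by
  rw [flatField, φ.nablaZero_sec X hx, iota, φ.Psi_sec γ hx, sub_eq_add_neg]

variable [LieGroup 𝓘(ℝ, EG) ∞ G]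

lemma Psi_act (γ : M → LieAlg EG G) {p : P} (hp : B.proj p ∈ φ.baseSet) (g : G) :
    φ.Psi γ (B.act p g) = Ad g⁻¹ (φ.Psi γ p) := by
  rw [Psi, Psi, φ.toHomeo_act hp, B.proj_act, mul_inv_rev, Ad_mul]

lemma tangentAct_flatField (X : (x : M) → TangentSpace 𝓘(ℝ, EM) x) (γ : M → LieAlg EG G) {p : P}
    (hp : B.proj p ∈ φ.baseSet) (g : G) :
    tangentAct B g p (φ.flatField X γ p) = φ.flatField X γ (B.act p g) := by
  rw [flatField, map_add, φ.tangentAct_nablaZero X hp, iota, map_neg, ← fundamental_act,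
    ← φ.Psi_act γ hp]
  rfl

lemma contMDiffOn_Psi {W : Set M} (hW : W ⊆ φ.baseSet) {γ : M → LieAlg EG G}
    (hγ : ContMDiffOn 𝓘(ℝ, EM) 𝓘(ℝ, EG) ∞ (M' := EG) γ W) :
    ContMDiffOn 𝓘(ℝ, EP) 𝓘(ℝ, EG) ∞ (M' := EG) (φ.Psi γ) (B.proj ⁻¹' W) :=
  contMDiffOn_Ad (φ.contMDiffOn_snd.mono fun _ hp => hW hp).inv
    (hγ.comp B.smooth_proj.contMDiffOn fun _ hp => hp)

variable [IsManifold 𝓘(ℝ, EM) ∞ M] [IsManifold 𝓘(ℝ, EP) ∞ P]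

lemma smoothFieldOn_nablaZero {W : Set M} (hW : W ⊆ φ.baseSet)
    {X : (x : M) → TangentSpace 𝓘(ℝ, EM) x} (hX : SmoothFieldOn X W) :
    SmoothFieldOn (φ.nablaZero X) (B.proj ⁻¹' W) := by
  have h1 : ContMDiffOn 𝓘(ℝ, EP) (𝓘(ℝ, EM).prod 𝓘(ℝ, EM)) ∞
      (fun p => (⟨B.proj p, X (B.proj p)⟩ : TangentBundle 𝓘(ℝ, EM) M)) (B.proj ⁻¹' W) :=
    ContMDiffOn.comp (t := W) hX B.smooth_proj.contMDiffOn (fun _ hp => hp)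
  have h2 := contMDiffOn_mfderiv_comp φ.isOpen_baseSet φ.contMDiffOn_sec h1 (fun _ hp => hW hp)
  have h3 : ContMDiffOn 𝓘(ℝ, EP) (𝓘(ℝ, EG).prod 𝓘(ℝ, EG)) ∞
      (fun p => (⟨(φ.toHomeo p).2, 0⟩ : TangentBundle 𝓘(ℝ, EG) G)) (B.proj ⁻¹' W) :=
    (Bundle.contMDiff_zeroSection ℝ (TangentSpace 𝓘(ℝ, EG) : G → Type _)).comp_contMDiffOn
      (φ.contMDiffOn_snd.mono fun _ hp => hW hp)
  refine (contMDiffOn_mfderiv_comp_prod isOpen_univ B.smooth_act.contMDiffOn h2 h3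
    (fun _ _ => Set.mem_univ _)).congr fun p hp => ?_
  refine tangentBundle_mk_congr (φ.act_sec (hW hp)).symm ?_
  rw [map_zero, add_zero]
  rfl

lemma smoothFieldOn_flatField {W : Set M} (hW : W ⊆ φ.baseSet)
    {X : (x : M) → TangentSpace 𝓘(ℝ, EM) x} (hX : SmoothFieldOn X W) {γ : M → LieAlg EG G}
    (hγ : ContMDiffOn 𝓘(ℝ, EM) 𝓘(ℝ, EG) ∞ (M' := EG) γ W) :
    SmoothFieldOn (φ.flatField X γ) (B.proj ⁻¹' W) :=
  ContMDiffOn.add_section (φ.smoothFieldOn_nablaZero hW hX)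
    (ContMDiffOn.neg_section (smoothFieldOn_fundamental (φ.contMDiffOn_Psi hW hγ)))

/-- The pull-back of a smooth form along the section of a local trivialization is smooth. -/
theorem smoothOn_pullback {V : Type*} [NormedAddCommGroup V] [NormedSpace ℝ V] {q : ℕ} {β : TLAForm EP P EG G V q}
    (hβ : β.SmoothOn Set.univ) : (β.pullback φ).SmoothOn φ.baseSet := by
  intro W hW hWU Y
  -- Smoothness of `β` is tested on sections over open subsets of `P`, so the vectors `Ts X` along
  -- the section are extended by the flat connection.
  let Y' : Fin q → TLASection EP EG G (B.proj ⁻¹' W) := fun k =>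
    ⟨φ.nablaZero (Y k).vec, fun p => (Y k).alg (B.proj p),
      φ.smoothFieldOn_nablaZero hWU (Y k).smooth_vec,
      (Y k).smooth_alg.comp B.smooth_proj.contMDiffOn fun _ hp => hp⟩
  have h := (hβ _ (hW.preimage B.smooth_proj.continuous) (Set.subset_univ _) Y').comp
    (φ.contMDiffOn_sec.mono hWU) (fun x hx => by
      rw [Set.mem_preimage, Set.mem_preimage, φ.proj_sec (hWU hx)]; exact hx)
  refine h.congr fun x hx => ?_
  refine congrArg (β (φ.sec x)) (funext fun k => ?_)
  refine Prod.ext ?_ ?_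
  · exact (φ.nablaZero_sec (Y k).vec (hWU hx)).symm
  · exact congrArg (Y k).alg (φ.proj_sec (hWU hx)).symm

end LocalTriv

end BundleGeometry

/-! ### Extension of invariant vector fields and locality of forms -/

section Locality

variable {EM EP EG : Type*}
  [NormedAddCommGroup EM] [NormedSpace ℝ EM] [FiniteDimensional ℝ EM]
  [NormedAddCommGroup EP] [NormedSpace ℝ EP] [NormedAddCommGroup EG] [NormedSpace ℝ EG]
  {M P G : Type*} [TopologicalSpace M] [ChartedSpace EM M] [IsManifold 𝓘(ℝ, EM) ∞ M] [T2Space M]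
  [TopologicalSpace P] [ChartedSpace EP P] [IsManifold 𝓘(ℝ, EP) ∞ P]
  [TopologicalSpace G] [ChartedSpace EG G] [Group G]
  {V : Type*} [NormedAddCommGroup V] [NormedSpace ℝ V]
  {B : PrincipalBundle EM EP EG M P G}

/-- A smooth function on `M` that is `1` near `x` and has its support in a given neighbourhood. -/
lemma exists_bump {x : M} {W : Set M} (hW : W ∈ 𝓝 x) :
    ∃ f : SmoothFun EM M, f =ᶠ[𝓝 x] 1 ∧ tsupport f ⊆ W := by
  obtain ⟨f, -, hf⟩ := (SmoothBumpFunction.nhds_basis_tsupport (I := 𝓘(ℝ, EM)) x).mem_iff.1 hW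
  exact ⟨⟨f, f.contMDiff⟩, f.eventuallyEq_one, hf⟩

/-- An invariant vector field over an open set `W` coincides near each point of `W` with a global
one. -/
lemma exists_invariantField {W : Set M} (hW : IsOpen W) {Z : (p : P) → TangentSpace 𝓘(ℝ, EP) p}
    (hZ : SmoothFieldOn Z (B.proj ⁻¹' W))
    (hinv : ∀ p, B.proj p ∈ W → ∀ g, tangentAct B g p (Z p) = Z (B.act p g)) {x : M} (hx : x ∈ W) :
    ∃ X : InvariantField B, ∀ᶠ y in 𝓝 x, ∀ p, B.proj p = y → X.val p = Z p := by
  obtain ⟨f, hf1, hfW⟩ := exists_bump (EM := EM) (hW.mem_nhds hx)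
  have hf0 : ∀ y, y ∉ W → f y = 0 := fun y hy =>
    image_eq_zero_of_notMem_tsupport fun h => hy (hfW h)
  -- The cut-off `f ∘ π` is constant on the fibres, so multiplication with it preserves invariance;
  -- outside `W` it vanishes.
  refine ⟨⟨fun p => f (B.proj p) • Z p, ?_, fun g p => ?_⟩, ?_⟩
  · refine contMDiffOn_univ.2 fun p => ?_
    by_cases hp : B.proj p ∈ tsupport f
    · have hW' : B.proj ⁻¹' W ∈ 𝓝 p :=
        (hW.preimage B.smooth_proj.continuous).mem_nhds (hfW hp)
      exact (ContMDiffOn.smul_section (s := Z)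
        ((f.contMDiff.comp B.smooth_proj).contMDiffOn) hZ).contMDiffAt hW'
    · have hW' : B.proj ⁻¹' (tsupport f)ᶜ ∈ 𝓝 p :=
        ((isClosed_tsupport f).isOpen_compl.preimage B.smooth_proj.continuous).mem_nhds hp
      refine (Bundle.contMDiff_zeroSection ℝ
        (TangentSpace 𝓘(ℝ, EP) : P → Type _)).contMDiffAt.congr_of_eventuallyEq ?_
      filter_upwards [hW'] with q hq
      have h0 : f (B.proj q) = 0 := image_eq_zero_of_notMem_tsupport hq
      change (⟨q, f (B.proj q) • Z q⟩ : TangentBundle 𝓘(ℝ, EP) P) = ⟨q, 0⟩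
      rw [h0, zero_smul]
  · change tangentAct B g p (f (B.proj p) • Z p) = f (B.proj (B.act p g)) • Z (B.act p g)
    rw [map_smul, B.proj_act]
    by_cases hp : B.proj p ∈ W
    · rw [hinv p hp]
    · rw [hf0 _ hp, zero_smul, zero_smul]
  · filter_upwards [hf1] with y hy p hp
    rw [hp, hy, Pi.one_apply, one_smul]

/-- The value of a form at `p` depends only on its arguments over a neighbourhood of `π(p)`. -/
lemma AtiyahForm.val_congr {C : Coeff EG G V} {q : ℕ} (α : AtiyahForm B C q)
    {X X' : Fin q → InvariantField B} {p : P}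
    (h : ∀ᶠ y in 𝓝 (B.proj p), ∀ k p', B.proj p' = y → (X k).val p' = (X' k).val p') :
    α.val X p = α.val X' p := by
  -- With `f` supported where the arguments agree, `f X_k = f X'_k` everywhere. Multilinearity
  -- extracts `f ^ q`, which is `1` at `π(p)`.
  obtain ⟨f, hf1, hfW⟩ := exists_bump (EM := EM) h
  have hXX' : (fun k => f • X k) = fun k => f • X' k := by
    refine funext fun k => Subtype.ext (funext fun p' => ?_)
    change f (B.proj p') • (X k).val p' = f (B.proj p') • (X' k).val p'
    by_cases hp' : B.proj p' ∈ tsupport f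
    · rw [hfW hp' k p' rfl]
    · rw [image_eq_zero_of_notMem_tsupport hp', zero_smul, zero_smul]
  have key : ∀ X : Fin q → InvariantField B, α.val (fun k => f • X k) p = α.val X p := by
    intro X
    have h1 := α.toMultilinearMap.map_smul_univ (fun _ => f) X
    have h2 : α.val (fun k => f • X k) p = (∏ _k : Fin q, f) (B.proj p) • α.val X p :=
      congrFun (congrArg Subtype.val h1) p
    have h3 : (∏ _k : Fin q, f) (B.proj p) = 1 := by
      rw [Finset.prod_const, ContMDiffMap.coe_pow, Pi.pow_apply, hf1.self_of_nhds, Pi.one_apply,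
        one_pow]
    rw [h2, h3, one_smul]
  rw [← key X, hXX', key X']

/-- Local trivializations are computed with any global extensions of the arguments. -/
lemma AtiyahForm.loc_eq {C : Coeff EG G V} {q : ℕ} (α : AtiyahForm B C q) (φ : B.Triv)
    (Y : Fin q → TLASection EM EG G φ.baseSet) (x : φ.baseSet) {X : Fin q → InvariantField B}
    (hX : ∀ᶠ y in 𝓝 (x : M), ∀ k p, B.proj p = y → (X k).val p = φ.S (Y k) p) :
    α.loc φ Y x = α.val X (φ.sec x) := by
  have hproj := φ.proj_sec x.2
  have hex : ∃ X : Fin q → InvariantField B, ∃ W ∈ 𝓝 (B.proj (φ.sec x)), ∀ k, ∀ p' : P,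
      B.proj p' ∈ W → (X k).val p' = φ.S (Y k) p' := by
    rw [hproj]
    exact ⟨X, _, hX, fun k p' hp' => hp' k p' rfl⟩
  change AtiyahForm.restrict α (fun k => φ.S (Y k)) (φ.sec x) = _
  -- An extension exists, so the default value `0` is not taken; locality then makes the chosen
  -- extension irrelevant.
  rw [AtiyahForm.restrict, dif_pos hex]
  obtain ⟨W, hW, h⟩ := hex.choose_spec
  refine α.val_congr ?_
  rw [← hproj] at hX
  filter_upwards [hW, hX] with y hy hy' k p' hp'
  rw [h k p' (hp' ▸ hy), hy' k p' hp']

variable [LieGroup 𝓘(ℝ, EG) ∞ G]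

/-- The invariant vector fields `S(Y)` of a local trivialization have global extensions. -/
lemma exists_extension_S (φ : B.Triv) {ι : Type*} [Finite ι]
    (Y : ι → TLASection EM EG G φ.baseSet) (x : φ.baseSet) :
    ∃ X : ι → InvariantField B,
      ∀ᶠ y in 𝓝 (x : M), ∀ k p, B.proj p = y → (X k).val p = φ.S (Y k) p := by
  have h : ∀ k, ∃ X : InvariantField B,
      ∀ᶠ y in 𝓝 (x : M), ∀ p, B.proj p = y → X.val p = φ.S (Y k) p := fun k =>
    exists_invariantField φ.isOpen_baseSet
      (φ.smoothFieldOn_flatField subset_rfl (Y k).smooth_vec (Y k).smooth_alg)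
      (fun p hp g => φ.tangentAct_flatField _ _ hp g) x.2
  choose X hX using h
  exact ⟨X, Filter.eventually_all.2 hX⟩

/-- The local trivialization of a form is the pull-back of a corresponding form on
`TLA(P, 𝔤)`. -/
theorem loc_eq_pullback {C : Coeff EG G V} {q : ℕ} {α : AtiyahForm B C q}
    {β : TLAForm EP P EG G V q} (h : Corresponds β α) (φ : B.Triv) :
    α.loc φ = (β.pullback φ).onSections := by
  funext Y x
  obtain ⟨X, hX⟩ := exists_extension_S φ Y x
  -- The maps `v_k` may be constant because only their values at `s(x)` matter.
  rw [α.loc_eq φ Y x hX, h X (fun k _ => (Y k).alg x) (fun k => contMDiff_const)]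
  refine congrArg (β (φ.sec x)) (funext fun k => ?_)
  have hk := (hX.self_of_nhds k _ (φ.proj_sec x.2)).trans
    (φ.flatField_sec (Y k).vec (Y k).alg x.2)
  refine Prod.ext ?_ rfl
  change (X k).val (φ.sec x) + fundamental B (φ.sec x) ((Y k).alg x) = _
  rw [hk, sub_add_cancel]
  rfl

end Locality

/-! ### Multilinear expressions in functions on a manifold -/

section Multilinear

variable {E : Type*} [NormedAddCommGroup E] [NormedSpace ℝ E]
  {N : Type*} [TopologicalSpace N] [ChartedSpace E N]
  {F V : Type*} [NormedAddCommGroup F] [NormedSpace ℝ F] [NormedAddCommGroup V] [NormedSpace ℝ V]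
  {n : ℕ}

lemma modelDeriv_multilinear_comp (D : ContinuousMultilinearMap ℝ (fun _ : Fin n => F) V)
    {σ : Fin n → N → F} {p : N} (hσ : ∀ k, MDifferentiableAt 𝓘(ℝ, E) 𝓘(ℝ, F) (σ k) p) (v : E) :
    modelDeriv (E := E) (E' := V) (fun q => D (fun k => σ k q)) p v =
      ∑ k, D (Function.update (fun j => σ j p) k (modelDeriv (E := E) (E' := F) (σ k) p v)) := by
  have h1 : HasMFDerivAt 𝓘(ℝ, E) 𝓘(ℝ, Fin n → F) (fun q k => σ k q) p
      (ContinuousLinearMap.pi fun k => modelDeriv (E := E) (E' := F) (σ k) p) :=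
    ⟨continuousAt_pi.2 fun k => (hσ k).continuousAt,
      hasFDerivWithinAt_pi.2 fun k => (hσ k).hasMFDerivAt.2⟩
  have h2 := ((D.hasFDerivAt (x := fun k => σ k p)).hasMFDerivAt.comp p h1).mfderiv
  have h3 := congrArg (fun L : E →L[ℝ] V => L v) h2
  refine h3.trans ?_
  change D.linearDeriv (fun k => σ k p) (fun k => modelDeriv (E := E) (E' := F) (σ k) p v) = _
  rw [ContinuousMultilinearMap.linearDeriv_apply]

lemma contMDiffOn_multilinear_comp (D : ContinuousMultilinearMap ℝ (fun _ : Fin n => F) V)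
    {σ : Fin n → N → F} {s : Set N} (hσ : ∀ k, ContMDiffOn 𝓘(ℝ, E) 𝓘(ℝ, F) ∞ (σ k) s) :
    ContMDiffOn 𝓘(ℝ, E) 𝓘(ℝ, V) ∞ (fun q => D (fun k => σ k q)) s :=
  D.contDiff.contMDiff.comp_contMDiffOn (contMDiffOn_pi_space.2 hσ)

/-- The form `c • b^1 ∧ … ∧ b^n` for the dual basis of a basis `b`, with values in `𝕜`. -/
def basisVolume [FiniteDimensional ℝ F] (𝕜 : Type*) [RCLike 𝕜] (b : Module.Basis (Fin n) ℝ F)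
    (c : ℝ) : ContinuousMultilinearMap ℝ (fun _ : Fin n => F) 𝕜 where
  toMultilinearMap := ((RCLike.ofRealCLM (K := 𝕜)).toLinearMap.compAlternatingMap
    (c • wedge b.coord)).toMultilinearMap
  cont := by
    have h : Continuous fun v : Fin n → F => (Matrix.of fun i j => b.coord j (v i)).det :=
      Continuous.matrix_det (continuous_matrix fun i j =>
        (LinearMap.continuous_of_finiteDimensional (b.coord j)).comp (continuous_apply i))
    exact (RCLike.ofRealCLM (K := 𝕜)).continuous.comp (h.const_smul c)

lemma basisVolume_apply [FiniteDimensional ℝ F] (𝕜 : Type*) [RCLike 𝕜]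
    (b : Module.Basis (Fin n) ℝ F) (c : ℝ) (v : Fin n → F) :
    basisVolume 𝕜 b c v = ((c * wedge b.coord v : ℝ) : 𝕜) := rfl

/-- Trace-free endomorphisms annihilate volume forms. -/
lemma sum_basisVolume_update [FiniteDimensional ℝ F] (𝕜 : Type*) [RCLike 𝕜]
    (b : Module.Basis (Fin n) ℝ F) (c : ℝ) (f : F →ₗ[ℝ] F) (hf : LinearMap.trace ℝ F f = 0)
    (v : Fin n → F) : ∑ k, basisVolume 𝕜 b c (Function.update v k (f (v k))) = 0 := by
  simp_rw [basisVolume_apply]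
  rw [← RCLike.ofReal_sum, ← Finset.mul_sum, sum_det_update_map, hf]
  simp

/-- A differentiable function with vanishing derivative on a connected manifold is constant. -/
lemma eq_of_modelDeriv_eq_zero [PreconnectedSpace N] [IsManifold 𝓘(ℝ, E) ∞ N] {f : N → F}
    (hf : ∀ p, MDifferentiableAt 𝓘(ℝ, E) 𝓘(ℝ, F) f p)
    (h0 : ∀ p, modelDeriv (E := E) (E' := F) f p = 0) (p q : N) : f p = f q := by
  refine IsLocallyConstant.apply_eq_of_preconnectedSpace
    ((IsLocallyConstant.iff_eventually_eq f).2 fun p => ?_) p q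
  -- In the chart `f` has derivative zero on a ball, hence is constant there; local constancy and
  -- connectedness suffice.
  obtain ⟨r, hr, hball⟩ := Metric.mem_nhds_iff.1 (extChartAt_target_mem_nhds_self (E := E) p)
  have hd : ∀ x ∈ (extChartAt 𝓘(ℝ, E) p).target,
      HasFDerivAt (f ∘ (extChartAt 𝓘(ℝ, E) p).symm) (0 : E →L[ℝ] F) x := by
    intro x hx
    have h1 : MDifferentiableAt 𝓘(ℝ, E) 𝓘(ℝ, E) (extChartAt 𝓘(ℝ, E) p).symm x :=
      ((contMDiffOn_extChartAt_symm (n := ∞) (I := 𝓘(ℝ, E)) p).contMDiffAt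
        ((isOpen_extChartAt_target p).mem_nhds hx)).mdifferentiableAt (by simp)
    have h2 : HasMFDerivAt 𝓘(ℝ, E) 𝓘(ℝ, F) f ((extChartAt 𝓘(ℝ, E) p).symm x)
        (0 : E →L[ℝ] F) := h0 ((extChartAt 𝓘(ℝ, E) p).symm x) ▸ (hf _).hasMFDerivAt
    have h3 := (h2.comp x h1.hasMFDerivAt).hasFDerivAt
    have h4 : ((0 : E →L[ℝ] F).comp (modelDeriv (E := E) (E' := E) (extChartAt 𝓘(ℝ, E) p).symm x))
        = 0 := ContinuousLinearMap.zero_comp _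
    exact h4 ▸ h3
  filter_upwards [(continuousAt_extChartAt (I := 𝓘(ℝ, E)) p).preimage_mem_nhds
    (Metric.ball_mem_nhds _ hr), extChartAt_source_mem_nhds (I := 𝓘(ℝ, E)) p] with y hy hy'
  have h := Metric.isOpen_ball.is_const_of_fderiv_eq_zero (𝕜 := ℝ)
    (convex_ball (extChartAt 𝓘(ℝ, E) p p) r).isPreconnected
    (f := f ∘ (extChartAt 𝓘(ℝ, E) p).symm)
    (fun x hx => (hd x (hball hx)).differentiableAt.differentiableWithinAt)
    (fun x hx => (hd x (hball hx)).fderiv) hy (Metric.mem_ball_self hr)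
  simp only [Function.comp_apply] at h
  rwa [(extChartAt 𝓘(ℝ, E) p).left_inv hy', extChartAt_to_inv] at h

end Multilinear

/-! ### Unimodularity -/

section Unimodular

variable {EG : Type*} [NormedAddCommGroup EG] [NormedSpace ℝ EG]
  {G : Type*} [TopologicalSpace G] [ChartedSpace EG G] [Group G] [LieGroup 𝓘(ℝ, EG) ∞ G]

lemma contMDiff_Ad_inv (η : LieAlg EG G) :
    ContMDiff 𝓘(ℝ, EG) 𝓘(ℝ, EG) ∞ (M' := EG) (fun g : G => (Ad g⁻¹ η : LieAlg EG G)) :=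
  contMDiffOn_univ.1 (contMDiffOn_Ad (contMDiff_inv 𝓘(ℝ, EG) ∞).contMDiffOn contMDiffOn_const)

/-- For a connected unimodular group, volume forms on the Lie algebra are invariant under the
adjoint representation. -/
theorem basisVolume_Ad [FiniteDimensional ℝ EG] [PreconnectedSpace G]
    (htr : ∀ ξ : LieAlg EG G, LinearMap.trace ℝ _ (LieAlgebra.ad ℝ (LieAlg EG G) ξ) = 0)
    (𝕜 : Type*) [RCLike 𝕜] {n : ℕ} (b : Module.Basis (Fin n) ℝ EG) (c : ℝ) (g : G)
    (v : Fin n → LieAlg EG G) :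
    basisVolume 𝕜 b c (fun k => (Ad g⁻¹ (v k) : LieAlg EG G)) = basisVolume 𝕜 b c v := by
  have hdiff : ∀ (v : Fin n → LieAlg EG G) (g : G), MDifferentiableAt 𝓘(ℝ, EG) 𝓘(ℝ, 𝕜)
      (fun g : G => basisVolume 𝕜 b c (fun k => (Ad g⁻¹ (v k) : LieAlg EG G))) g := fun v g =>
    (contMDiffOn_univ.1 (contMDiffOn_multilinear_comp (basisVolume 𝕜 b c)
      (fun k => (contMDiff_Ad_inv (v k)).contMDiffOn))).mdifferentiableAt (by simp)
  -- By the Leibniz rule the derivative at `1` is the derivation by `-ad ξ`, which is trace-free. It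
  -- is needed for all `v`, as the reduction from `g` to `1` changes the vectors.
  have hone : ∀ (v : Fin n → LieAlg EG G) (ξ : EG), modelDeriv (E := EG) (E' := 𝕜)
      (fun g : G => basisVolume 𝕜 b c (fun k => (Ad g⁻¹ (v k) : LieAlg EG G))) 1 ξ = 0 := by
    intro v ξ
    rw [modelDeriv_multilinear_comp (E := EG) (F := EG) (basisVolume 𝕜 b c)
      (fun k => (contMDiff_Ad_inv (v k)).mdifferentiableAt (by simp))]
    have h1 : (fun j => (Ad (1 : G)⁻¹ (v j) : LieAlg EG G)) = v := by
      funext j; rw [inv_one, Ad_one]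
    have h2 := sum_basisVolume_update 𝕜 b c
      (-(LieAlgebra.ad ℝ (LieAlg EG G) ξ) : LieAlg EG G →ₗ[ℝ] LieAlg EG G)
      ((map_neg _ _).trans (neg_eq_zero.2 (htr ξ))) v
    refine Eq.trans (Finset.sum_congr rfl fun k _ => ?_) h2
    refine congrArg (basisVolume 𝕜 b c) ?_
    exact congrArg₂ (fun (u : Fin n → EG) w => Function.update u k w) h1 (modelDeriv_Ad_inv ξ (v k))
  have h := eq_of_modelDeriv_eq_zero (E := EG) (hdiff v) (fun g => ?_) g 1
  · refine h.trans (congrArg (basisVolume 𝕜 b c) (funext fun k => ?_))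
    rw [inv_one, Ad_one]
  · ext ξ
    -- Since `Ad_{h⁻¹} = Ad_{(g⁻¹h)⁻¹} Ad_{g⁻¹}`, the derivative at `g` is a derivative at `1` for
    -- the vectors `Ad_{g⁻¹} v_k`.
    have h1 := modelDeriv_comp (E₁ := EG) (E₂ := EG) (E₃ := 𝕜) (p := g) (q := 1)
      (h := fun g : G => basisVolume 𝕜 b c (fun k => (Ad g⁻¹ (v k) : LieAlg EG G)))
      (g := fun h : G => basisVolume 𝕜 b c (fun k => (Ad h⁻¹ (Ad g⁻¹ (v k)) : LieAlg EG G)))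
      (f := fun h => g⁻¹ * h) (.of_forall fun h => ?_) (by simp) (hdiff _ _)
      (mdifferentiableAt_mul_left _ _) ξ
    · rw [h1]
      exact hone _ _
    · refine congrArg (basisVolume 𝕜 b c) (funext fun k => ?_)
      rw [← Ad_mul]
      congr 2
      group

end Unimodular

section VolumeForm

variable {EM EP EG : Type*}
  [NormedAddCommGroup EM] [NormedSpace ℝ EM]
  [NormedAddCommGroup EP] [NormedSpace ℝ EP]
  [NormedAddCommGroup EG] [NormedSpace ℝ EG]
  {M P G : Type*} [TopologicalSpace M] [ChartedSpace EM M]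
  [TopologicalSpace P] [ChartedSpace EP P] [IsManifold 𝓘(ℝ, EP) ∞ P]
  [TopologicalSpace G] [ChartedSpace EG G] [Group G]
  {B : PrincipalBundle EM EP EG M P G}

/-! ### The connection form minus the canonical form -/

/-- The `𝔤`-valued form `ω_∇ - θ` on `TLA(P, 𝔤)`. -/
def Connection.tlaForm (A : Connection B) (p : P) (w : TLAFiber EP EG G p) : LieAlg EG G :=
  A.form p w.1 - w.2

lemma Connection.contMDiffOn_tlaForm (A : Connection B) {W : Set P} (hW : IsOpen W)
    (Y : TLASection EP EG G W) :
    ContMDiffOn 𝓘(ℝ, EP) 𝓘(ℝ, EG) ∞ (M' := EG) (fun p => A.tlaForm p (Y.val p)) W :=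
  ContMDiffOn.sub (A.smooth_form W hW Y.vec Y.smooth_vec) Y.smooth_alg

variable [FiniteDimensional ℝ EG] [LieGroup 𝓘(ℝ, EG) ∞ G]

/-- The Lie derivative of a connection form along a fundamental vector field. -/
theorem Connection.lieDeriv_form [FiniteDimensional ℝ EP] (A : Connection B) (ξ : LieAlg EG G)
    {Y : (p : P) → TangentSpace 𝓘(ℝ, EP) p} (hY : SmoothFieldOn Y Set.univ) (p : P) :
    (show LieAlg EG G from dirDeriv (V := EG) (fun q => A.form q (Y q)) p (fundamental B p ξ)) -
      A.form p (VectorField.mlieBracket 𝓘(ℝ, EP) (fun q => fundamental B q ξ) Y p) =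
      -⁅ξ, A.form p (Y p)⁆ := by
  have hY' := (contMDiffOn_univ.1 hY).mdifferentiableAt (x := p) (by simp)
  have key := mfderiv_pullback_act (E := EP) (E' := EG) (F := EG) B.smooth_act 1 B.act_one
    (θ := A.form) A.smooth_form hY' ξ
  -- Equivariance turns the pulled-back family into `g ↦ Ad_{g⁻¹} (ω_∇(Y_p))`, whose derivative at
  -- `1` is known.
  have h : (fun g : G => (A.form (B.act p g) (modelDeriv (E := EP) (E' := EP)
      (fun q => B.act q g) p (Y p)) : LieAlg EG G)) =
      fun g => Ad g⁻¹ (A.form p (Y p)) := funext fun g => A.form_act g p (Y p)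
  have h2 := modelDeriv_Ad_inv ξ (A.form p (Y p))
  rw [← h] at h2
  exact key.symm.trans h2

/-- The form `ω_∇ - θ` is invariant under `𝔤_equ`. -/
theorem Connection.lieDeriv_tlaForm [FiniteDimensional ℝ EP] (A : Connection B) (ξ : LieAlg EG G)
    (Y : TLASection EP EG G (Set.univ : Set P)) (p : P) :
    (show LieAlg EG G from modelDeriv (E := EP) (E' := EG) (N' := EG)
      (fun q => A.tlaForm q (Y.val q)) p (fundamental B p ξ)) =
    A.tlaForm p (tlaBracket (fun q => fundamental B q ξ) Y.vec (fun _ => ξ) Y.alg p) -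
      ⁅ξ, A.tlaForm p (Y.val p)⁆ := by
  have h1 := A.lieDeriv_form ξ Y.smooth_vec p
  have ha : MDifferentiableAt 𝓘(ℝ, EP) 𝓘(ℝ, EG) (M' := EG) (fun q => A.form q (Y.vec q)) p :=
    (contMDiffOn_univ.1 (A.smooth_form _ isOpen_univ Y.vec Y.smooth_vec)).mdifferentiableAt
      (by simp)
  have hb : MDifferentiableAt 𝓘(ℝ, EP) 𝓘(ℝ, EG) (M' := EG) Y.alg p :=
    (contMDiffOn_univ.1 Y.smooth_alg).mdifferentiableAt (by simp)
  have h2 : modelDeriv (E := EP) (E' := EG) (N' := EG)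
      (fun q => A.tlaForm q (Y.val q)) p (fundamental B p ξ) =
      dirDeriv (V := EG) (fun q => A.form q (Y.vec q)) p (fundamental B p ξ) -
      dirDeriv (V := EG) Y.alg p (fundamental B p ξ) :=
    congrArg (fun L : EP →L[ℝ] EG => L (fundamental B p ξ))
      (ha.hasMFDerivAt.sub hb.hasMFDerivAt).mfderiv
  -- The term `Y · ξ` in the bracket vanishes because `ξ` is constant.
  have h3 : (dirDeriv (V := EG) (E := EP) (fun _ : P => (ξ : EG)) p (Y.vec p)) = 0 :=
    congrArg (fun L : EP →L[ℝ] EG => L (Y.vec p))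
      (mfderiv_const (I := 𝓘(ℝ, EP)) (I' := 𝓘(ℝ, EG)) (M' := EG) (c := ξ) (x := p))
  have h4 : A.tlaForm p (tlaBracket (fun q => fundamental B q ξ) Y.vec (fun _ => ξ) Y.alg p) =
      A.form p (VectorField.mlieBracket 𝓘(ℝ, EP) (fun q => fundamental B q ξ) Y.vec p) -
      ((show LieAlg EG G from dirDeriv (V := EG) Y.alg p (fundamental B p ξ)) - 0 +
        ⁅ξ, Y.alg p⁆) :=
    congrArg (fun u : LieAlg EG G =>
      A.form p (VectorField.mlieBracket 𝓘(ℝ, EP) (fun q => fundamental B q ξ) Y.vec p) -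
      ((show LieAlg EG G from dirDeriv (V := EG) Y.alg p (fundamental B p ξ)) - u +
        ⁅ξ, Y.alg p⁆)) h3
  have h5 : ⁅ξ, A.tlaForm p (Y.val p)⁆ = ⁅ξ, A.form p (Y.vec p)⁆ - ⁅ξ, Y.alg p⁆ := lie_sub _ _ _
  rw [h4, h5]
  refine Eq.trans h2 ?_
  rw [sub_eq_iff_eq_add] at h1
  refine Eq.trans (congrArg (fun u : LieAlg EG G => u -
    (show LieAlg EG G from dirDeriv (V := EG) Y.alg p (fundamental B p ξ))) h1) ?_
  abel

/-! ### The volume form on `TLA(P, 𝔤)` -/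

/-- Presents the form as a constant multilinear map applied to `ω_∇ - θ`, so that its properties are
inherited from this one-form. -/
lemma volumeTLAForm_apply (𝕜 : Type*) [RCLike 𝕜] {n : ℕ} (b : Module.Basis (Fin n) ℝ (LieAlg EG G))
    (A : Connection B) (p : P) (Y : Fin n → TLAFiber EP EG G p) :
    volumeTLAForm 𝕜 b A p Y =
      basisVolume (F := EG) 𝕜 b ((-1) ^ n * sqrtKilling b) (fun k => A.tlaForm p (Y k)) := by
  have h : ∀ i k, (b.coord i ∘ₗ A.form p) (Y k).1 - b.coord i (Y k).2 =
      b.coord i (A.tlaForm p (Y k)) := fun i k => (map_sub (b.coord i) _ _).symm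
  refine congrArg (fun d : ℝ => (((-1) ^ n * sqrtKilling b * d : ℝ) : 𝕜)) ?_
  refine congrArg Matrix.det (Matrix.ext fun k i => ?_)
  exact h i k

lemma volumeTLAForm_smoothOn (𝕜 : Type*) [RCLike 𝕜] {n : ℕ}
    (b : Module.Basis (Fin n) ℝ (LieAlg EG G)) (A : Connection B) :
    (volumeTLAForm 𝕜 b A).SmoothOn Set.univ := by
  intro W hW _ Y
  simp_rw [volumeTLAForm_apply]
  exact contMDiffOn_multilinear_comp (F := EG) _ fun k => A.contMDiffOn_tlaForm hW (Y k)

/-- Horizontality holds because `ω_∇ - θ` kills `ξ^P ⊕ ξ`. In the Lie derivative the bracket terms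
cancel those from the Leibniz rule, up to the derivation by `ad ξ`, which is `tr (ad ξ)` times the
form. -/
theorem volumeTLAForm_isBasic [FiniteDimensional ℝ EP]
    (htr : ∀ ξ : LieAlg EG G, LinearMap.trace ℝ _ (LieAlgebra.ad ℝ (LieAlg EG G) ξ) = 0)
    (𝕜 : Type*) [RCLike 𝕜] {n : ℕ} (b : Module.Basis (Fin n) ℝ (LieAlg EG G))
    (A : Connection B) : IsBasic B (scalar EG G 𝕜) (volumeTLAForm 𝕜 b A) := by
  refine ⟨volumeTLAForm_smoothOn 𝕜 b A, fun ξ p k Y hk => ?_, fun ξ Y p => ?_⟩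
  · rw [volumeTLAForm_apply]
    refine ContinuousMultilinearMap.map_coord_zero _ k ?_
    rw [hk]
    exact sub_eq_zero.2 (A.form_fundamental p ξ)
  · set D := basisVolume (F := EG) 𝕜 b ((-1) ^ n * sqrtKilling b) with hD
    have h1 : dirDeriv (fun p' => volumeTLAForm 𝕜 b A p' (fun k => (Y k).val p')) p
        (fundamental B p ξ) = ∑ k, D (Function.update (fun j => A.tlaForm p ((Y j).val p)) k
          (modelDeriv (E := EP) (E' := EG) (N' := EG)
            (fun q => A.tlaForm q ((Y k).val q)) p (fundamental B p ξ))) := by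
      simp_rw [volumeTLAForm_apply]
      exact modelDeriv_multilinear_comp (E := EP) (F := EG) D (fun k =>
        (contMDiffOn_univ.1 (A.contMDiffOn_tlaForm isOpen_univ (Y k))).mdifferentiableAt
          (by simp)) _
    have h2 : ∀ k, volumeTLAForm 𝕜 b A p (Function.update (fun j => (Y j).val p) k
        (tlaBracket (fun p' => fundamental B p' ξ) (Y k).vec (fun _ => ξ) (Y k).alg p)) =
        D (Function.update (fun j => A.tlaForm p ((Y j).val p)) k (A.tlaForm p
          (tlaBracket (fun p' => fundamental B p' ξ) (Y k).vec (fun _ => ξ) (Y k).alg p))) := by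
      intro k
      rw [volumeTLAForm_apply]
      refine congrArg D (funext fun j => ?_)
      exact Function.apply_update (fun _ w => A.tlaForm p w) _ k _ j
    have h3 := sum_basisVolume_update (F := EG) 𝕜 b ((-1) ^ n * sqrtKilling b)
      (LieAlgebra.ad ℝ (LieAlg EG G) ξ : LieAlg EG G →ₗ[ℝ] LieAlg EG G) (htr ξ)
      (fun j => A.tlaForm p ((Y j).val p))
    have h4 : ∀ k, D (Function.update (fun j => A.tlaForm p ((Y j).val p)) k
          (modelDeriv (E := EP) (E' := EG) (N' := EG)
            (fun q => A.tlaForm q ((Y k).val q)) p (fundamental B p ξ))) =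
        D (Function.update (fun j => A.tlaForm p ((Y j).val p)) k (A.tlaForm p
          (tlaBracket (fun p' => fundamental B p' ξ) (Y k).vec (fun _ => ξ) (Y k).alg p))) -
        D (Function.update (fun j => A.tlaForm p ((Y j).val p)) k
          ((LieAlgebra.ad ℝ (LieAlg EG G) ξ) (A.tlaForm p ((Y k).val p)))) := by
      intro k
      refine Eq.trans ?_ (D.map_update_sub (fun j => A.tlaForm p ((Y j).val p)) k _ _)
      exact congrArg (fun w : EG => D (Function.update (fun j => A.tlaForm p ((Y j).val p)) k w))
        (A.lieDeriv_tlaForm ξ (Y k) p)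
    have h5 : (scalar EG G 𝕜).infAct ξ (volumeTLAForm 𝕜 b A p fun k => (Y k).val p) = 0 := rfl
    unfold lieDeriv
    rw [h1, h5, Finset.sum_congr rfl fun k _ => h2 k, Finset.sum_congr rfl fun k _ => h4 k,
      Finset.sum_sub_distrib, add_zero, sub_sub_cancel_left, neg_eq_zero]
    exact h3

end VolumeForm

/-! ### The chain rule for a map of two variables. -/

section ChainRule

variable {E N E₁ N₁ E₂ N₂ E₃ N₃ : Type*} [NormedAddCommGroup E] [NormedSpace ℝ E]
  [TopologicalSpace N] [ChartedSpace E N] [NormedAddCommGroup E₁] [NormedSpace ℝ E₁]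
  [TopologicalSpace N₁] [ChartedSpace E₁ N₁] [NormedAddCommGroup E₂] [NormedSpace ℝ E₂]
  [TopologicalSpace N₂] [ChartedSpace E₂ N₂] [NormedAddCommGroup E₃] [NormedSpace ℝ E₃]
  [TopologicalSpace N₃] [ChartedSpace E₃ N₃]

lemma modelDeriv_comp_prod {f : N₁ × N₂ → N₃} {f₁ : N → N₁} {f₂ : N → N₂} {p : N}
    {a : N₁} {b : N₂} (ha : f₁ p = a) (hb : f₂ p = b)
    (hf : MDifferentiableAt (𝓘(ℝ, E₁).prod 𝓘(ℝ, E₂)) 𝓘(ℝ, E₃) f (a, b))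
    (h₁ : MDifferentiableAt 𝓘(ℝ, E) 𝓘(ℝ, E₁) f₁ p) (h₂ : MDifferentiableAt 𝓘(ℝ, E) 𝓘(ℝ, E₂) f₂ p)
    (v : E) : modelDeriv (E := E) (E' := E₃) (fun q => f (f₁ q, f₂ q)) p v =
      modelDeriv (E := E₁) (E' := E₃) (fun x => f (x, b)) a
        (modelDeriv (E := E) (E' := E₁) f₁ p v) +
      modelDeriv (E := E₂) (E' := E₃) (fun y => f (a, y)) b
        (modelDeriv (E := E) (E' := E₂) f₂ p v) := by
  subst ha hb
  have h := (hf.hasMFDerivAt.comp p (h₁.hasMFDerivAt.prodMk h₂.hasMFDerivAt)).mfderiv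
  refine (congrArg (fun L : E →L[ℝ] E₃ => L v) h).trans ?_
  exact mfderiv_prod_eq_add_apply (I := 𝓘(ℝ, E₁)) (I' := 𝓘(ℝ, E₂)) (I'' := 𝓘(ℝ, E₃)) (f := f)
    (p := (f₁ p, f₂ p)) (v := (modelDeriv (E := E) (E' := E₁) f₁ p v,
      modelDeriv (E := E) (E' := E₂) f₂ p v)) hf

end ChainRule

/-! ### Invariant vector fields over the domain of a local trivialization -/

section InvariantFields

variable {EM EP EG : Type*}
  [NormedAddCommGroup EM] [NormedSpace ℝ EM]
  [NormedAddCommGroup EP] [NormedSpace ℝ EP]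
  [NormedAddCommGroup EG] [NormedSpace ℝ EG]
  {M P G : Type*} [TopologicalSpace M] [ChartedSpace EM M]
  [TopologicalSpace P] [ChartedSpace EP P]
  [TopologicalSpace G] [ChartedSpace EG G] [Group G]
  {B : PrincipalBundle EM EP EG M P G}

namespace LocalTriv

variable (φ : B.Triv)

lemma exists_eq_act_sec {p : P} (hp : B.proj p ∈ φ.baseSet) :
    ∃ x ∈ φ.baseSet, ∃ g, B.act (φ.sec x) g = p :=
  ⟨_, hp, _, φ.act_sec hp⟩

/-- The tangent space at a point of the section is the sum of the tangent space of the section and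
of the vertical space. -/
lemma exists_eq_add_fundamental {x : M} (hx : x ∈ φ.baseSet) (u : EP) :
    ∃ w : LieAlg EG G, u = modelDeriv (E := EM) (E' := EP) φ.sec x
      (modelDeriv (E := EP) (E' := EM) B.proj (φ.sec x) u) +
      modelDeriv (E := EG) (E' := EP) (fun g : G => B.act (φ.sec x) g) 1 w := by
  have hpx := φ.proj_sec hx
  have hp : B.proj (φ.sec x) ∈ φ.baseSet := by rwa [hpx]
  have hopen : B.proj ⁻¹' φ.baseSet ∈ 𝓝 (φ.sec x) :=
    (φ.isOpen_baseSet.preimage B.smooth_proj.continuous).mem_nhds hp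
  have hproj : MDifferentiableAt 𝓘(ℝ, EP) 𝓘(ℝ, EM) B.proj (φ.sec x) :=
    B.smooth_proj.mdifferentiableAt (by simp)
  have h1 : MDifferentiableAt 𝓘(ℝ, EP) 𝓘(ℝ, EP) (fun q => φ.sec (B.proj q)) (φ.sec x) :=
    (φ.mdifferentiableAt_sec hp).comp _ hproj
  have h2 : MDifferentiableAt 𝓘(ℝ, EP) 𝓘(ℝ, EG) (fun q => (φ.toHomeo q).2) (φ.sec x) :=
    (φ.contMDiffOn_snd.contMDiffAt hopen).mdifferentiableAt (by simp)
  -- Near the section each `q` is `s(π(q)) · g(q)`; differentiating this identity gives the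
  -- decomposition, and `w` is the derivative of `g(q)`.
  have h3 := modelDeriv_comp_prod (E := EP) (E₁ := EP) (E₂ := EG) (E₃ := EP)
    (f := fun z : P × G => B.act z.1 z.2) (a := φ.sec x) (b := 1) (by rw [hpx])
    (by rw [φ.toHomeo_sec hx]) (B.smooth_act.mdifferentiableAt (by simp)) h1 h2 u
  have h4 : modelDeriv (E := EP) (E' := EP)
      (fun q => B.act (φ.sec (B.proj q)) (φ.toHomeo q).2) (φ.sec x) u = u :=
    modelDeriv_of_eventually_eq_self (by
      filter_upwards [hopen] with q hq using φ.act_sec hq) u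
  have h5 := modelDeriv_comp (E₁ := EP) (E₂ := EM) (E₃ := EP)
    (h := fun q => φ.sec (B.proj q)) (.of_forall fun _ => rfl) hpx (φ.mdifferentiableAt_sec hx)
    hproj u
  refine ⟨modelDeriv (E := EP) (E' := EG) (fun q => (φ.toHomeo q).2) (φ.sec x) u, ?_⟩
  rw [h4] at h3
  refine h3.trans (congrArg₂ (· + ·) ?_ rfl)
  rw [tangentAct_one]
  exact h5

variable [IsManifold 𝓘(ℝ, EM) ∞ M] [IsManifold 𝓘(ℝ, EP) ∞ P]

/-- The vector field on the domain of a local trivialization induced by an invariant vector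
field. -/
def baseField (X : InvariantField B) (x : M) : TangentSpace 𝓘(ℝ, EM) x :=
  (modelDeriv (E := EP) (E' := EM) B.proj (φ.sec x) (X.val (φ.sec x)) : EM)

lemma smoothFieldOn_baseField (X : InvariantField B) :
    SmoothFieldOn (φ.baseField X) φ.baseSet := by
  have h1 : ContMDiffOn 𝓘(ℝ, EM) (𝓘(ℝ, EP).prod 𝓘(ℝ, EP)) ∞
      (fun x => (⟨φ.sec x, X.val (φ.sec x)⟩ : TangentBundle 𝓘(ℝ, EP) P)) φ.baseSet :=
    ContMDiffOn.comp (t := Set.univ) X.2.1 φ.contMDiffOn_sec (fun _ _ => Set.mem_univ _)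
  refine (contMDiffOn_mfderiv_comp isOpen_univ B.smooth_proj.contMDiffOn h1
    (fun _ _ => Set.mem_univ _)).congr fun x hx => ?_
  exact tangentBundle_mk_congr (φ.proj_sec hx).symm rfl

variable [LieGroup 𝓘(ℝ, EG) ∞ G]

/-- The section of `TLA(U, 𝔤)` that corresponds to an invariant vector field in a local
trivialization. -/
def toTLASection (A : Connection B) (X : InvariantField B) : TLASection EM EG G φ.baseSet where
  vec := φ.baseField X
  -- From `X = ∇⁰ - γ^P` on the section, `γ` is recovered by applying `ω_∇` to the vertical vector
  -- `∇⁰ - X`. The smoothness of `ω_∇` then gives that of `γ`.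
  alg x := A.form (φ.sec x) (φ.nablaZero (φ.baseField X) (φ.sec x)) -
    A.form (φ.sec x) (X.val (φ.sec x))
  smooth_vec := φ.smoothFieldOn_baseField X
  smooth_alg := by
    have hmaps : ∀ x ∈ φ.baseSet, φ.sec x ∈ B.proj ⁻¹' φ.baseSet := fun x hx => by
      rw [Set.mem_preimage, φ.proj_sec hx]; exact hx
    have hopen := φ.isOpen_baseSet.preimage B.smooth_proj.continuous
    have h1 := (A.smooth_form _ hopen _ (φ.smoothFieldOn_nablaZero subset_rfl
      (φ.smoothFieldOn_baseField X))).comp φ.contMDiffOn_sec hmaps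
    have h2 := (A.smooth_form _ isOpen_univ _ X.2.1).comp φ.contMDiffOn_sec
      (fun _ _ => Set.mem_univ _)
    exact ContMDiffOn.sub h1 h2

/-- On the section the vertical parts agree by the choice of `alg`; both fields are invariant, so
they agree on the whole of `P|_U`. -/
lemma S_toTLASection (A : Connection B) (X : InvariantField B) {p : P}
    (hp : B.proj p ∈ φ.baseSet) : φ.S (φ.toTLASection A X) p = X.val p := by
  obtain ⟨x, hx, g, rfl⟩ := φ.exists_eq_act_sec hp
  have hs : B.proj (φ.sec x) ∈ φ.baseSet := by rwa [φ.proj_sec hx]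
  have key : φ.flatField (φ.baseField X) (φ.toTLASection A X).alg (φ.sec x) =
      X.val (φ.sec x) := by
    obtain ⟨w, hw⟩ := φ.exists_eq_add_fundamental hx (X.val (φ.sec x))
    have hw' : X.val (φ.sec x) = mfderiv 𝓘(ℝ, EM) 𝓘(ℝ, EP) φ.sec x (φ.baseField X x) +
      fundamental B (φ.sec x) w := hw
    have halg : (φ.toTLASection A X).alg x = -w := by
      change A.form (φ.sec x) (φ.nablaZero (φ.baseField X) (φ.sec x)) -
        A.form (φ.sec x) (X.val (φ.sec x)) = -w
      rw [φ.nablaZero_sec _ hx, hw', map_add, A.form_fundamental]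
      abel
    have hneg : fundamental B (φ.sec x) (-w) = -fundamental B (φ.sec x) w :=
      map_neg (modelDeriv (E := EG) (E' := EP) (fun g : G => B.act (φ.sec x) g) 1) w
    rw [φ.flatField_sec _ _ hx, halg, hneg, sub_neg_eq_add, hw']
  have h1 := φ.tangentAct_flatField (φ.baseField X) (φ.toTLASection A X).alg hs g
  rw [key] at h1
  exact h1.symm.trans (X.2.2 g (φ.sec x))

end LocalTriv

variable [FiniteDimensional ℝ EM] [T2Space M] [IsManifold 𝓘(ℝ, EM) ∞ M] [IsManifold 𝓘(ℝ, EP) ∞ P]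
  [LieGroup 𝓘(ℝ, EG) ∞ G]

/-- Every tangent vector of `P` is the value of an invariant vector field. -/
lemma exists_invariantField_val_eq (p : P) (u : TangentSpace 𝓘(ℝ, EP) p) :
    ∃ X : InvariantField B, X.val p = u := by
  obtain ⟨φ, hφ⟩ := B.exists_localTriv (B.proj p)
  obtain ⟨x, hx, g, rfl⟩ := LocalTriv.exists_eq_act_sec (B := B) φ hφ
  have hs : B.proj (LocalTriv.sec (B := B) φ x) = x := LocalTriv.proj_sec (B := B) φ hx
  -- By invariance it suffices to realize the vector `u` moved back to the section by `R_{g⁻¹}`.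
  let u' : EP := modelDeriv (E := EP) (E' := EP) (fun q : P => B.act q g⁻¹)
    (B.act (LocalTriv.sec (B := B) φ x) g) u
  have hu : tangentAct B g (LocalTriv.sec (B := B) φ x) u' = u := by
    have h := tangentAct_mul (B := B) g⁻¹ g (p := B.act (LocalTriv.sec (B := B) φ x) g)
      (p' := LocalTriv.sec (B := B) φ x)
      (by rw [← B.act_mul, mul_inv_cancel, B.act_one]) u
    rw [inv_mul_cancel] at h
    exact h.symm.trans (tangentAct_one _ _)
  obtain ⟨w, hw⟩ := LocalTriv.exists_eq_add_fundamental (B := B) φ hx u'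
  set v : EM := modelDeriv (E := EP) (E' := EM) B.proj (LocalTriv.sec (B := B) φ x) u'
  -- The horizontal part is extended by a field with constant coefficients in a chart; the vertical
  -- part `w` comes from the constant `γ = -w`, the sign being that of `ι`.
  let Z : (y : M) → TangentSpace 𝓘(ℝ, EM) y := fun y =>
    (chartSymmDeriv (E := EM) x (extChartAt 𝓘(ℝ, EM) x y) v : EM)
  have hZ : SmoothFieldOn Z (chartAt EM x).source := smoothFieldOn_chartSymmDeriv x v
  have hZx : (Z x : EM) = v := congrArg (fun L : EM →L[ℝ] EM => L v) (chartSymmDeriv_self x)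
  have hval : LocalTriv.flatField (B := B) φ Z (fun _ => -w) (LocalTriv.sec (B := B) φ x) = u' := by
    have hneg : fundamental B (LocalTriv.sec (B := B) φ x) (-w) =
        -fundamental B (LocalTriv.sec (B := B) φ x) w :=
      map_neg (modelDeriv (E := EG) (E' := EP)
        (fun g : G => B.act (LocalTriv.sec (B := B) φ x) g) 1) w
    rw [LocalTriv.flatField_sec (B := B) φ _ _ hx, hneg, sub_neg_eq_add]
    refine Eq.trans ?_ hw.symm
    exact congrArg (fun z : EM => modelDeriv (E := EM) (E' := EP) (LocalTriv.sec (B := B) φ) x z +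
      modelDeriv (E := EG) (E' := EP) (fun g : G => B.act (LocalTriv.sec (B := B) φ x) g) 1 w) hZx
  have hsub : φ.baseSet ∩ (chartAt EM x).source ⊆ φ.baseSet := Set.inter_subset_left
  obtain ⟨X, hX⟩ := exists_invariantField (B := B)
    (φ.isOpen_baseSet.inter (chartAt EM x).open_source)
    (LocalTriv.smoothFieldOn_flatField (B := B) φ hsub (hZ.mono Set.inter_subset_right)
      (contMDiffOn_const (c := (-w : LieAlg EG G)) (M' := EG)))
    (fun p hp g => LocalTriv.tangentAct_flatField (B := B) φ _ _ (hsub hp) g)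
    ⟨hx, mem_chart_source EM x⟩
  refine ⟨X, ?_⟩
  rw [hX.self_of_nhds _ ((B.proj_act _ _).trans hs),
    ← LocalTriv.tangentAct_flatField (B := B) φ _ _ (by rwa [hs]) g, hval, hu]

/-- A form on `TLA(P, 𝔤)` is determined by the corresponding form on the Atiyah Lie algebroid. -/
theorem Corresponds.eq {V : Type*} [NormedAddCommGroup V] [NormedSpace ℝ V] {C : Coeff EG G V}
    {q : ℕ} {β β' : TLAForm EP P EG G V q} {α : AtiyahForm B C q} (h : Corresponds β α)
    (h' : Corresponds β' α) : β = β' := by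
  refine funext fun p => AlternatingMap.ext fun Y => ?_
  -- Subtracting the vertical part makes `(X_k + v_k^P) ⊕ v_k`, with `v_k` constant, pass through
  -- the arbitrary fibre vector `Y_k`.
  choose X hX using fun k =>
    exists_invariantField_val_eq (B := B) p ((Y k).1 - fundamental B p (Y k).2)
  have hY : (fun k => ((X k).val p + fundamental B p (Y k).2, (Y k).2)) = Y :=
    funext fun k => Prod.ext (by rw [hX, sub_add_cancel]) rfl
  have e := (h X (fun k _ => (Y k).2) (fun k => contMDiff_const) p).symm.trans
    (h' X (fun k _ => (Y k).2) (fun k => contMDiff_const) p)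
  rwa [hY] at e

end InvariantFields

/-! ### The volume form on the Atiyah Lie algebroid -/

section AtiyahVolume

variable {EM EP EG : Type*}
  [NormedAddCommGroup EM] [NormedSpace ℝ EM]
  [NormedAddCommGroup EP] [NormedSpace ℝ EP]
  [NormedAddCommGroup EG] [NormedSpace ℝ EG]
  {M P G : Type*} [TopologicalSpace M] [ChartedSpace EM M]
  [TopologicalSpace P] [ChartedSpace EP P] [IsManifold 𝓘(ℝ, EP) ∞ P]
  [TopologicalSpace G] [ChartedSpace EG G] [Group G]
  {B : PrincipalBundle EM EP EG M P G}

/-- An invariant vector field `X`, as the element `X ⊕ 0` of `TLA(P, 𝔤)`. -/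
def sectionOfField (X : InvariantField B) :
    TLASection EP EG G (Set.univ : Set P) where
  vec := X.val
  alg _ := 0
  smooth_vec := X.2.1
  smooth_alg := contMDiffOn_const (c := (0 : EG))

lemma Connection.tlaForm_sectionOfField (A : Connection B) (X : InvariantField B) (p : P) :
    A.tlaForm p ((sectionOfField X).val p) = A.form p (X.val p) :=
  sub_zero _

variable [FiniteDimensional ℝ EG] [LieGroup 𝓘(ℝ, EG) ∞ G]

/-- On invariant fields `ω_∇` changes by `Ad_{g⁻¹}` along the fibre, which preserves the determinant
by unimodularity and connectedness. This makes the values functions on `M`. -/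
lemma volumeTLAForm_sectionOfField_act [PreconnectedSpace G]
    (htr : ∀ ξ : LieAlg EG G, LinearMap.trace ℝ _ (LieAlgebra.ad ℝ (LieAlg EG G) ξ) = 0)
    (𝕜 : Type*) [RCLike 𝕜] {n : ℕ} (b : Module.Basis (Fin n) ℝ (LieAlg EG G)) (A : Connection B)
    (X : Fin n → InvariantField B) (p : P) (g : G) :
    volumeTLAForm 𝕜 b A (B.act p g) (fun k => (sectionOfField (X k)).val (B.act p g)) =
      volumeTLAForm 𝕜 b A p (fun k => (sectionOfField (X k)).val p) := by
  have h : ∀ k, A.form (B.act p g) ((X k).val (B.act p g)) = Ad g⁻¹ (A.form p ((X k).val p)) := by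
    intro k
    rw [← A.form_act g p ((X k).val p)]
    exact congrArg (A.form (B.act p g)) ((X k).2.2 g p).symm
  simp_rw [volumeTLAForm_apply, A.tlaForm_sectionOfField, h]
  exact basisVolume_Ad htr 𝕜 b _ g _

/-- The volume form of the Killing form and of a connection on the Atiyah Lie algebroid. -/
def volumeAtiyahForm [PreconnectedSpace G]
    (htr : ∀ ξ : LieAlg EG G, LinearMap.trace ℝ _ (LieAlgebra.ad ℝ (LieAlg EG G) ξ) = 0)
    (𝕜 : Type*) [RCLike 𝕜] {n : ℕ} (b : Module.Basis (Fin n) ℝ (LieAlg EG G))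
    (A : Connection B) : AtiyahForm B (scalar EG G 𝕜) n where
  toFun X := ⟨fun p => volumeTLAForm 𝕜 b A p (fun k => (sectionOfField (X k)).val p),
    contMDiffOn_univ.1 (volumeTLAForm_smoothOn 𝕜 b A Set.univ isOpen_univ subset_rfl _),
    fun p g => volumeTLAForm_sectionOfField_act htr 𝕜 b A X p g⟩
  map_update_add' {inst} X i Y Z := by
    -- Multilinearity is demanded for every decidability instance on the indices; all of them
    -- coincide with the standard one.
    obtain rfl : inst = instDecidableEqFin n := Subsingleton.elim _ _
    refine Subtype.ext (funext fun p => ?_)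
    have h : ∀ T : InvariantField B,
        (fun k => (sectionOfField (Function.update X i T k)).val p) =
        Function.update (fun k => (sectionOfField (X k)).val p) i ((sectionOfField T).val p) := fun T =>
      funext fun k => Function.apply_update (fun _ T => (sectionOfField T).val p) X i T k
    have h' : (sectionOfField (Y + Z)).val p = (sectionOfField Y).val p + (sectionOfField Z).val p :=
      Prod.ext rfl (add_zero _).symm
    change volumeTLAForm 𝕜 b A p _ = volumeTLAForm 𝕜 b A p _ + volumeTLAForm 𝕜 b A p _
    rw [h, h, h, h', AlternatingMap.map_update_add]
  map_update_smul' {inst} X i f Y := by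
    obtain rfl : inst = instDecidableEqFin n := Subsingleton.elim _ _
    refine Subtype.ext (funext fun p => ?_)
    have h : ∀ T : InvariantField B,
        (fun k => (sectionOfField (Function.update X i T k)).val p) =
        Function.update (fun k => (sectionOfField (X k)).val p) i ((sectionOfField T).val p) := fun T =>
      funext fun k => Function.apply_update (fun _ T => (sectionOfField T).val p) X i T k
    have h' : (sectionOfField (f • Y)).val p = f (B.proj p) • (sectionOfField Y).val p :=
      Prod.ext rfl (smul_zero _).symm
    change volumeTLAForm 𝕜 b A p _ = f (B.proj p) • volumeTLAForm 𝕜 b A p _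
    rw [h, h, h', AlternatingMap.map_update_smul]
  map_eq_zero_of_eq' X i j hXij hij := by
    refine Subtype.ext (funext fun p => ?_)
    exact (volumeTLAForm 𝕜 b A p).map_eq_zero_of_eq _
      (congrArg (fun T : InvariantField B => (sectionOfField T).val p) hXij) hij

/-- Adding `v^P ⊕ v` does not change the value of `ω_∇ - θ`. -/
lemma corresponds_volumeAtiyahForm [PreconnectedSpace G]
    (htr : ∀ ξ : LieAlg EG G, LinearMap.trace ℝ _ (LieAlgebra.ad ℝ (LieAlg EG G) ξ) = 0)
    (𝕜 : Type*) [RCLike 𝕜] {n : ℕ} (b : Module.Basis (Fin n) ℝ (LieAlg EG G))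
    (A : Connection B) : Corresponds (volumeTLAForm 𝕜 b A) (volumeAtiyahForm htr 𝕜 b A) := by
  intro X v _ p
  change volumeTLAForm 𝕜 b A p _ = _
  rw [volumeTLAForm_apply, volumeTLAForm_apply]
  refine congrArg _ (funext fun k => ?_)
  change A.tlaForm p ((sectionOfField (X k)).val p) =
    A.form p ((X k).val p + fundamental B p (v k p)) - v k p
  rw [A.tlaForm_sectionOfField, map_add, A.form_fundamental, add_sub_cancel_right]

variable [IsManifold 𝓘(ℝ, EM) ∞ M] [FiniteDimensional ℝ EM] [T2Space M]

/-- The same global extensions compute the local trivializations of the volume form and of the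
connection form, and on `X ⊕ 0` the form `ω_∇ - θ` is `ω_∇(X)`. -/
theorem isVolumeForm_volumeAtiyahForm [PreconnectedSpace G]
    (htr : ∀ ξ : LieAlg EG G, LinearMap.trace ℝ _ (LieAlgebra.ad ℝ (LieAlg EG G) ξ) = 0)
    (𝕜 : Type*) [RCLike 𝕜] {n : ℕ} (b : Module.Basis (Fin n) ℝ (LieAlg EG G))
    (A : Connection B) : IsVolumeForm b A (volumeAtiyahForm htr 𝕜 b A) := by
  intro φ Y x
  obtain ⟨X, hX⟩ := exists_extension_S φ Y x
  have hA : ∀ j, A.lieForm.loc φ (fun _ => Y j) x = A.form (φ.sec x) ((X j).val (φ.sec x)) :=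
    fun j => A.lieForm.loc_eq φ (fun _ => Y j) x (X := fun _ => X j)
      (hX.mono fun y hy _ p hp => hy j p hp)
  rw [AtiyahForm.loc_eq _ φ Y x hX]
  change volumeTLAForm 𝕜 b A (φ.sec x) _ = _
  rw [volumeTLAForm_apply]
  refine congrArg (fun d : ℝ => (((-1) ^ n * sqrtKilling b * d : ℝ) : 𝕜)) ?_
  -- In `wedge` the arguments index the rows, in `IsVolumeForm` the columns.
  rw [← Matrix.det_transpose]
  refine congrArg Matrix.det (Matrix.ext fun j i => ?_)
  exact congrArg (b.coord i) ((A.tlaForm_sectionOfField (X j) (φ.sec x)).trans (hA j).symm)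

/-- The volume form is determined by its local trivializations. -/
theorem IsVolumeForm.eq {𝕜 : Type*} [RCLike 𝕜] {n : ℕ}
    {b : Module.Basis (Fin n) ℝ (LieAlg EG G)} {A : Connection B}
    {α α' : AtiyahForm B (scalar EG G 𝕜) n} (h : IsVolumeForm b A α) (h' : IsVolumeForm b A α') :
    α = α' := by
  refine AlternatingMap.ext fun X => Subtype.ext (funext fun p => ?_)
  obtain ⟨φ, hφ⟩ := B.exists_localTriv (B.proj p)
  obtain ⟨x, hx, g, rfl⟩ := LocalTriv.exists_eq_act_sec (B := B) φ hφ
  -- Each global field extends its own local expression, so the local trivializations see all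
  -- arguments.
  have hX : ∀ᶠ y in 𝓝 x, ∀ k p, B.proj p = y →
      (X k).val p = LocalTriv.S (B := B) φ (LocalTriv.toTLASection (B := B) φ A (X k)) p := by
    filter_upwards [φ.isOpen_baseSet.mem_nhds hx] with y hy k p hp
    exact (LocalTriv.S_toTLASection (B := B) φ A (X k) (hp ▸ hy)).symm
  have hloc := (h φ (fun k => LocalTriv.toTLASection (B := B) φ A (X k)) ⟨x, hx⟩).trans
    (h' φ (fun k => LocalTriv.toTLASection (B := B) φ A (X k)) ⟨x, hx⟩).symm
  rw [α.loc_eq φ _ ⟨x, hx⟩ hX, α'.loc_eq φ _ ⟨x, hx⟩ hX] at hloc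
  -- Equality on the section spreads along the fibre, as scalar values are constant there.
  exact ((α X).2.2 _ g).trans (hloc.trans ((α' X).2.2 _ g).symm)

end AtiyahVolume

end Atiyah

end

/-! ### The main theorem. -/

theorem mainTheorem10
    {EM EP EG : Type*}
    [NormedAddCommGroup EM] [NormedSpace ℝ EM] [FiniteDimensional ℝ EM]
    [NormedAddCommGroup EP] [NormedSpace ℝ EP] [FiniteDimensional ℝ EP]
    [NormedAddCommGroup EG] [NormedSpace ℝ EG] [FiniteDimensional ℝ EG]
    {M P G : Type*}
    [TopologicalSpace M] [ChartedSpace EM M] [IsManifold 𝓘(ℝ, EM) ∞ M]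
    [T2Space M] [SecondCountableTopology M]
    [TopologicalSpace P] [ChartedSpace EP P] [IsManifold 𝓘(ℝ, EP) ∞ P]
    [T2Space P] [SecondCountableTopology P]
    [TopologicalSpace G] [ChartedSpace EG G] [Group G] [LieGroup 𝓘(ℝ, EG) ∞ G]
    [T2Space G] [SecondCountableTopology G] [SimplyConnectedSpace G]
    [LieAlgebra.IsSemisimple ℝ (Atiyah.LieAlg EG G)]
    (hunimodular : ∀ ξ : Atiyah.LieAlg EG G,
      LinearMap.trace ℝ _ (LieAlgebra.ad ℝ (Atiyah.LieAlg EG G) ξ) = 0)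
    (B : Atiyah.PrincipalBundle EM EP EG M P G) :
    -- forms with values in the kernel: local trivializations are pull-backs of the basic form
    (∀ (q : ℕ) (α : Atiyah.AtiyahForm B (Atiyah.adjoint EG G) q)
      (β : Atiyah.TLAForm EP P EG G EG q),
      Atiyah.IsBasic B (Atiyah.adjoint EG G) β → Atiyah.Corresponds β α →
      ∀ φ : B.Triv, (β.pullback φ).SmoothOn φ.baseSet ∧
        α.loc φ = (β.pullback φ).onSections) ∧
    -- the same with complex coefficients
    (∀ (q : ℕ) (α : Atiyah.AtiyahForm B (Atiyah.adjointC EG G) q)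
      (β : Atiyah.TLAForm EP P EG G (EG × EG) q),
      Atiyah.IsBasic B (Atiyah.adjointC EG G) β → Atiyah.Corresponds β α →
      ∀ φ : B.Triv, (β.pullback φ).SmoothOn φ.baseSet ∧
        α.loc φ = (β.pullback φ).onSections) ∧
    -- the volume form exists, is unique, and has the stated corresponding basic form
    (∀ (𝕜 : Type) [RCLike 𝕜] (n : ℕ) (b : Module.Basis (Fin n) ℝ (Atiyah.LieAlg EG G))
      (A : Atiyah.Connection B),
      (∃! α : Atiyah.AtiyahForm B (Atiyah.scalar EG G 𝕜) n, Atiyah.IsVolumeForm b A α) ∧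
      ∀ α : Atiyah.AtiyahForm B (Atiyah.scalar EG G 𝕜) n, Atiyah.IsVolumeForm b A α →
        Atiyah.IsBasic B (Atiyah.scalar EG G 𝕜) (Atiyah.volumeTLAForm 𝕜 b A) ∧
        Atiyah.Corresponds (Atiyah.volumeTLAForm 𝕜 b A) α ∧
        ∀ β : Atiyah.TLAForm EP P EG G 𝕜 n,
          Atiyah.IsBasic B (Atiyah.scalar EG G 𝕜) β → Atiyah.Corresponds β α →
          β = Atiyah.volumeTLAForm 𝕜 b A) := by
  refine ⟨fun q α β hβ hcorr φ => ⟨φ.smoothOn_pullback hβ.1, Atiyah.loc_eq_pullback hcorr φ⟩,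
    fun q α β hβ hcorr φ => ⟨φ.smoothOn_pullback hβ.1, Atiyah.loc_eq_pullback hcorr φ⟩,
    fun 𝕜 _ n b A => ?_⟩
  have hvol := Atiyah.isVolumeForm_volumeAtiyahForm hunimodular 𝕜 b A
  refine ⟨⟨_, hvol, fun α hα => hα.eq hvol⟩, fun α hα => ?_⟩
  -- By uniqueness an arbitrary volume form is the one constructed from the basic form, for which
  -- the correspondence holds.
  obtain rfl := hα.eq hvol
  have hcorr := Atiyah.corresponds_volumeAtiyahForm hunimodular 𝕜 b A
  exact ⟨Atiyah.volumeTLAForm_isBasic hunimodular 𝕜 b A, hcorr, fun β _ hβ => hβ.eq hcorr⟩
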